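/- A partition is a finite multiset of positive integers; write $\lambda=(1^{m_1}2^{m_2}\cdots)$ if $i$ occurs $m_i$ times as a part of $\lambda$, let $|\lambda|$ be the sum and $\ell(\lambda)$ the number of its parts, $\lambda'$ the conjugate (transposed) partition, $\operatorname{sgn}(\lambda)=(-1)^{\#\{\text{even parts of }\lambda\}}$, and $z_\lambda=\prod_{i\ge 1} m_i!\,i^{m_i}$. Put $2\lambda=(1^{2m_1}2^{2m_2}\cdots)$, $2\cdot\lambda=(2^{m_1}4^{m_2}\cdots)$, and let $\lambda\cup\mu$ be the partition in which the multiplicities of $\lambda$ and $\mu$ are added. For $\lambda,\pi\vdash n$ let $\chi^\lambda_\pi$ be the value of the irreducible complex character of the symmetric group $S_n$ attached to $\lambda$ (the character of the Specht module of $\lambda$, so that $\lambda=(n)$ gives the trivial and $\lambda=(1^n)$ the sign character) at the permutations of cycle type $\pi$. For a partition $\pi$ define $$C^{\pm}_\pi=\sum \frac{(-1)^{\ell(\tau_s)}}{z_{\rho_+}\,z_{\rho_-}\,z_{2\cdot\tau_s}\,z_{2\cdot\tau_p}},$$ where the sum is over all quadruples of partitions $(\rho_+,\rho_-,\tau_s,\tau_p)$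 with $\rho_+\cup\rho_-\cup 2\cdot\tau_s\cup 2\tau_p=\pi$ and with $|\rho_-|$ even for $C^+_\pi$, and $|\rho_-|$ odd for $C^-_\pi$. Put $C_\pi=C^+_\pi+C^-_\pi$ and $D_\pi=C^+_\pi-C^-_\pi$, and for a partition $\lambda$ of $n\ge 0$ define $$a^+_\lambda=\sum_{\pi\vdash n}\operatorname{sgn}(\pi)\,C_\pi\,\chi^\lambda_\pi,\qquad a^-_\lambda=\sum_{\pi\vdash n}\operatorname{sgn}(\pi)\,D_\pi\,\chi^\lambda_\pi .$$ Theorem. For every partition $\lambda=(1^{r_1}2^{r_2}\cdots)$, $$a^+_\lambda=(r_1+1)(r_2+1)\cdots,\qquad a^-_\lambda=\begin{cases}1&\text{if all parts of }\lambda'\text{ are even,}\\0&\text{otherwise.}\end{cases}$$ -/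

import Mathlib

namespace SchurMult

/-! ### Partitions

A partition is a multiset of positive integers; partitions of `n` are Mathlib's `Nat.Partition n`,
with underlying multiset `parts`. The union `lam ∪ mu` (adding multiplicities) is the sum of
multisets, and for `s = 2` the two operations `s · lam` (multiply every part by `s`) and `s lam`
(multiply every multiplicity by `s`) are `lam.map (2 * ·)` and `2 • lam`. -/

/-- `z_μ = ∏ i, r_i! * i ^ r_i` for `μ = (1^{r₁} 2^{r₂} ⋯)`. -/
def zee (m : Multiset ℕ) : ℕ :=
  ∏ i ∈ m.toFinset, (m.count i).factorial * i ^ m.count i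

/-- The parity `(-1) ^ (number of even parts)`. -/
def parity (m : Multiset ℕ) : ℤ :=
  (-1) ^ m.countP Even

/-- The finite set of all partitions of all integers `k ≤ N`. -/
def partitionsUpTo (N : ℕ) : Finset (Multiset ℕ) :=
  (Finset.range (N + 1)).biUnion fun k =>
    (Finset.univ : Finset (Nat.Partition k)).image Nat.Partition.parts

/-- The set of quadruples `(ρ₊, ρ₋, τ_s, τ_p)` of partitions with
`ρ₊ ∪ ρ₋ ∪ 2 · τ_s ∪ 2 τ_p = m`. Each of them has weight at most `|m|`, so nothing is lost by
taking them in the finite set `partitionsUpTo |m|`; see `mem_quadruples`. -/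
def quadruples (m : Multiset ℕ) :
    Finset (Multiset ℕ × Multiset ℕ × Multiset ℕ × Multiset ℕ) :=
  (partitionsUpTo m.sum ×ˢ partitionsUpTo m.sum ×ˢ partitionsUpTo m.sum ×ˢ
    partitionsUpTo m.sum).filter
    fun q => q.1 + q.2.1 + q.2.2.1.map (2 * ·) + 2 • q.2.2.2 = m

theorem mem_partitionsUpTo {N : ℕ} {m : Multiset ℕ} :
    m ∈ partitionsUpTo N ↔ (∀ i ∈ m, 0 < i) ∧ m.sum ≤ N := by
  simp only [partitionsUpTo, Finset.mem_biUnion, Finset.mem_range, Finset.mem_image,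
    Finset.mem_univ, true_and]
  constructor
  · rintro ⟨k, hk, p, rfl⟩
    exact ⟨fun i hi => p.parts_pos hi, by rw [p.parts_sum]; omega⟩
  · rintro ⟨h, hs⟩
    exact ⟨m.sum, by omega, ⟨m, fun {i} hi => h i hi, rfl⟩, rfl⟩

theorem mem_quadruples {m a b s t : Multiset ℕ} :
    (a, b, s, t) ∈ quadruples m ↔
      (∀ i ∈ a, 0 < i) ∧ (∀ i ∈ b, 0 < i) ∧ (∀ i ∈ s, 0 < i) ∧ (∀ i ∈ t, 0 < i) ∧
        a + b + s.map (2 * ·) + 2 • t = m := by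
  simp only [quadruples, Finset.mem_filter, Finset.mem_product, mem_partitionsUpTo]
  constructor
  · rintro ⟨⟨h1, h2, h3, h4⟩, h⟩
    exact ⟨h1.1, h2.1, h3.1, h4.1, h⟩
  · rintro ⟨h1, h2, h3, h4, h⟩
    have hsum : a.sum + b.sum + 2 * s.sum + 2 * t.sum = m.sum := by
      rw [← h]
      simp [two_nsmul, two_mul]
    exact ⟨⟨⟨h1, by omega⟩, ⟨h2, by omega⟩, ⟨h3, by omega⟩, ⟨h4, by omega⟩⟩, h⟩

/-- The summand `(-1)^{ℓ(τ_s)} / (z_{ρ₊} z_{ρ₋} z_{2·τ_s} z_{2·τ_p})`. -/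
noncomputable def quadWeight (q : Multiset ℕ × Multiset ℕ × Multiset ℕ × Multiset ℕ) : ℂ :=
  (-1) ^ q.2.2.1.card /
    ((zee q.1 : ℂ) * zee q.2.1 * zee (q.2.2.1.map (2 * ·)) * zee (q.2.2.2.map (2 * ·)))

/-- `C⁺_π`: the quadruples with `|ρ₋|` even. -/
noncomputable def Cplus (m : Multiset ℕ) : ℂ :=
  ∑ q ∈ (quadruples m).filter (fun q => Even q.2.1.sum), quadWeight q

/-- `C⁻_π`: the quadruples with `|ρ₋|` odd. -/
noncomputable def Cminus (m : Multiset ℕ) : ℂ :=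
  ∑ q ∈ (quadruples m).filter (fun q => Odd q.2.1.sum), quadWeight q

/-- `C_π = C⁺_π + C⁻_π`. -/
noncomputable def coeffC (m : Multiset ℕ) : ℂ := Cplus m + Cminus m

/-- `D_π = C⁺_π - C⁻_π`. -/
noncomputable def coeffD (m : Multiset ℕ) : ℂ := Cplus m - Cminus m

/-! ### Young diagrams of partitions -/

/-- The Young diagram of a partition: its `i`-th row has length the `i`-th largest part. -/
def diagram {n : ℕ} (lam : Nat.Partition n) : YoungDiagram :=
  YoungDiagram.ofRowLens (lam.parts.sort (· ≥ ·)) (lam.parts.pairwise_sort (· ≥ ·)).sortedGE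

/-- The parts of the conjugate partition: the row lengths of the transposed diagram. -/
def conjParts {n : ℕ} (lam : Nat.Partition n) : Multiset ℕ :=
  ((diagram lam).transpose.rowLens : Multiset ℕ)

theorem card_cells {n : ℕ} (lam : Nat.Partition n) : (diagram lam).cells.card = n := by
  have key : ∀ w : List ℕ, (YoungDiagram.cellsOfRowLens w).card = w.sum := by
    intro w
    induction w with
    | nil => rfl
    | cons k w ih =>
      rw [YoungDiagram.cellsOfRowLens, Finset.card_union_of_disjoint, Finset.card_map, ih]
      · simp
      · rw [Finset.disjoint_left]
        rintro ⟨i, j⟩ h1 h2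
        simp only [Finset.mem_product, Finset.mem_singleton] at h1
        obtain ⟨c, _, hc⟩ := Finset.mem_map.1 h2
        have h3 : c.1.succ = i := congrArg Prod.fst hc
        omega
  have h := key (lam.parts.sort (· ≥ ·))
  rw [← Multiset.sum_coe, Multiset.sort_eq, lam.parts_sum] at h
  exact h

/-! ### The irreducible characters of the symmetric group -/

section Specht

variable {n : ℕ} (lam : Nat.Partition n)

/-- A numbering of the cells of the diagram of `lam` by `Fin n` (a Young tableau). -/
noncomputable def tableau : (diagram lam).cells ≃ Fin n :=
  Finset.equivFinOfCardEq (card_cells lam)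

/-- The row of the tableau that contains the entry `i`. -/
noncomputable def rowOf (i : Fin n) : ℕ := ((tableau lam).symm i : ℕ × ℕ).1

/-- The column of the tableau that contains the entry `i`. -/
noncomputable def colOf (i : Fin n) : ℕ := ((tableau lam).symm i : ℕ × ℕ).2

/-- The row symmetrizer `∑ σ`, over the permutations preserving each row. -/
noncomputable def rowSymmetrizer : MonoidAlgebra ℂ (Equiv.Perm (Fin n)) :=
  ∑ σ : Equiv.Perm (Fin n) with ∀ i, rowOf lam (σ i) = rowOf lam i, MonoidAlgebra.of ℂ _ σ

/-- The column antisymmetrizer `∑ sgn(σ) σ`, over the permutations preserving each column. -/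
noncomputable def colAntisymmetrizer : MonoidAlgebra ℂ (Equiv.Perm (Fin n)) :=
  ∑ σ : Equiv.Perm (Fin n) with ∀ i, colOf lam (σ i) = colOf lam i,
    ((Equiv.Perm.sign σ : ℤ) : ℂ) • MonoidAlgebra.of ℂ _ σ

/-- The irreducible `ℂ[S_n]`-module attached to `lam`: the left ideal generated by the Young
symmetrizer. For `lam = (n)` it is the trivial, for `lam = (1^n)` the sign representation. -/
noncomputable def spechtModule : Ideal (MonoidAlgebra ℂ (Equiv.Perm (Fin n))) :=
  Ideal.span {rowSymmetrizer lam * colAntisymmetrizer lam}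

/-- The representation of `S_n` on the Specht module, by left multiplication. -/
noncomputable def spechtRep : Representation ℂ (Equiv.Perm (Fin n)) (spechtModule lam) :=
  ((Algebra.lsmul ℂ ℂ (spechtModule lam)).toRingHom.toMonoidHom).comp
    (MonoidAlgebra.of ℂ (Equiv.Perm (Fin n)))

theorem exists_perm_of_partition (π : Nat.Partition n) :
    ∃ σ : Equiv.Perm (Fin n), σ.partition.parts = π.parts := by
  have hsplit := Multiset.filter_add_not (fun i => 2 ≤ i) π.parts
  have hone : π.parts.filter (fun i => ¬ 2 ≤ i) =
      Multiset.replicate (π.parts.filter (fun i => ¬ 2 ≤ i)).card 1 := by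
    rw [Multiset.eq_replicate_card]
    intro i hi
    rw [Multiset.mem_filter] at hi
    have := π.parts_pos hi.1
    omega
  have hsum : (π.parts.filter (fun i => 2 ≤ i)).sum +
      (π.parts.filter (fun i => ¬ 2 ≤ i)).card = n := by
    have h := congrArg Multiset.sum hsplit
    rw [Multiset.sum_add, π.parts_sum, hone, Multiset.sum_replicate] at h
    simpa using h
  obtain ⟨σ, hσ⟩ := (Equiv.Perm.exists_with_cycleType_iff (Fin n)
    (m := π.parts.filter (fun i => 2 ≤ i))).2
    ⟨by rw [Fintype.card_fin]; omega, fun a ha => (Multiset.mem_filter.1 ha).2⟩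
  refine ⟨σ, ?_⟩
  have hcard : Fintype.card (Fin n) - σ.support.card =
      (π.parts.filter (fun i => ¬ 2 ≤ i)).card := by
    rw [← Equiv.Perm.sum_cycleType, hσ, Fintype.card_fin]
    omega
  rw [Equiv.Perm.parts_partition, hσ, hcard, ← hone]
  exact hsplit

/-- `χ^lam_π`: the value of the irreducible character of `S_n` attached to `lam` at a permutation
of cycle type `π` (fixed points counted as parts `1`). -/
noncomputable def chi (π : Nat.Partition n) : ℂ :=
  (spechtRep lam).character (exists_perm_of_partition π).choose

/-- The choice of the permutation in `chi` is immaterial. -/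
theorem chi_eq (π : Nat.Partition n) (σ : Equiv.Perm (Fin n)) (h : σ.partition.parts = π.parts) :
    chi lam π = (spechtRep lam).character σ := by
  have hc : IsConj (exists_perm_of_partition π).choose σ :=
    Equiv.Perm.partition_eq_of_isConj.2
      (Nat.Partition.ext ((exists_perm_of_partition π).choose_spec.trans h.symm))
  obtain ⟨g, hg⟩ := isConj_iff.1 hc
  rw [chi, ← hg, Representation.char_conj]

/-- `a⁺_lam = ∑_{π ⊢ n} sgn(π) C_π χ^lam_π`. -/
noncomputable def aPlus : ℂ :=
  ∑ π : Nat.Partition n, (parity π.parts : ℂ) * coeffC π.parts * chi lam π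

/-- `a⁻_lam = ∑_{π ⊢ n} sgn(π) D_π χ^lam_π`. -/
noncomputable def aMinus : ℂ :=
  ∑ π : Nat.Partition n, (parity π.parts : ℂ) * coeffD π.parts * chi lam π

end Specht

end SchurMult

/-! Both signs are treated at once by weighting a quadruple with `s ^ |ρ₋|`: `s = 1` gives `C_π` and
`s = -1` gives `D_π`. Write `p_π` for products of power sums. In the generating function of `∑_π
sgn(π) C_π p_π` the four partitions vary independently, so it is a product of formal exponentials
`exp (∑ P_k t^k / k)`. The exponent `P_k` is `-(-1)^k p_k` for `ρ₊` and `-(-s)^k p_k` for `ρ₋`; for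
even `k` only, it is `p_k` for `τ_s` and `p_{k/2}²` for `τ_p`.

The exponents of `ρ₊`, `τ_s` and `τ_p` add up to `p_k` for odd `k` and `p_{k/2}²` for even `k`. This
describes how cycles behave under squaring, so the degree `n` part of that product is `(1/n!) ∑_h
p_{type(h²)}`. Its coefficient at the Schur function of `λ` is the Frobenius–Schur indicator of the
Specht module, which is `1` (`sum_character_sq`). Hence these three factors give the sum of all
Schur functions (`cf_alternant_mul_cycleExp_squareWeight`). The factor of `ρ₋` is `∑ s^r e_r`.

By Pieri's rule the coefficient at `λ` in the product is `∑ s^|S|` over the vertical strips `S` that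
can be removed from `λ`. Such a strip takes, for each `v`, the lowest `j` of the `r_v` rows of
length `v`, with `0 ≤ j ≤ r_v`. The sum is therefore `∏_v (1 + s + ⋯ + s^{r_v})`
(`sum_parity_coeffSign_chi`). At `s = 1` this is `∏ (r_v + 1)`. At `s = -1` it is `1` or `0`
according to whether all `r_v` are even, and the `r_v` are the differences of successive column
lengths.

Schur functions are never defined: their coefficients are read off as coefficients of `x^{λ+δ}`
after multiplication by the alternant. The bridge to the Specht characters is the Frobenius formula
`chi_eq_psi`. It is proved by uniqueness: sums over row stabilizers and signed sums over column
stabilizers make both families triangular for the dominance order, in opposite directions, and this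
determines a family up to its diagonal values. -/

namespace SchurMult

open Finset

/-! ### Combinatorics of tableaux and the dominance order -/

section Counting

variable {n : ℕ}

/-- The number of cells of `lam` in the first `m` columns; comparing these numbers for all `m` is
the (reversed) dominance order. -/
def colWeight (lam : Nat.Partition n) (m : ℕ) : ℕ := #{c ∈ (diagram lam).cells | c.2 < m}

theorem card_filter_tableau (lam : Nat.Partition n) (P : ℕ × ℕ → Prop) [DecidablePred P] :
    #{i : Fin n | P ((tableau lam).symm i)} = #{c ∈ (diagram lam).cells | P c} := by
  refine Finset.card_bij (fun i _ => ((tableau lam).symm i : ℕ × ℕ)) ?_ ?_ ?_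
  · intro i hi
    simp only [Finset.mem_filter, Finset.mem_univ, true_and] at hi
    exact Finset.mem_filter.2 ⟨((tableau lam).symm i).2, hi⟩
  · intro i _ j _ h
    exact (tableau lam).symm.injective (Subtype.ext h)
  · intro c hc
    rw [Finset.mem_filter] at hc
    exact ⟨tableau lam ⟨c, hc.1⟩, by simpa using hc.2, by simp⟩

theorem colWeight_eq (lam : Nat.Partition n) (m : ℕ) :
    colWeight lam m = #{i : Fin n | colOf lam i < m} :=
  (card_filter_tableau lam fun c => c.2 < m).symm

theorem card_rowOf_colOf_lt (lam : Nat.Partition n) (k m : ℕ) :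
    #{i : Fin n | rowOf lam i = k ∧ colOf lam i < m} = min ((diagram lam).rowLen k) m := by
  rw [show #{i : Fin n | rowOf lam i = k ∧ colOf lam i < m} = _ from
    card_filter_tableau lam fun c => c.1 = k ∧ c.2 < m]
  have : {c ∈ (diagram lam).cells | c.1 = k ∧ c.2 < m} =
      ({k} : Finset ℕ) ×ˢ range (min ((diagram lam).rowLen k) m) := by
    ext ⟨i, j⟩
    simp only [Finset.mem_filter, YoungDiagram.mem_cells, YoungDiagram.mem_iff_lt_rowLen,
      Finset.mem_product, Finset.mem_singleton, Finset.mem_range, lt_min_iff]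
    constructor
    · rintro ⟨h, rfl, h'⟩
      exact ⟨rfl, h, h'⟩
    · rintro ⟨rfl, h, h'⟩
      exact ⟨h, rfl, h'⟩
  rw [this]
  simp

theorem card_rowOf (lam : Nat.Partition n) (k : ℕ) :
    #{i : Fin n | rowOf lam i = k} = (diagram lam).rowLen k := by
  rw [show #{i : Fin n | rowOf lam i = k} = _ from card_filter_tableau lam fun c => c.1 = k,
    YoungDiagram.rowLen_eq_card, YoungDiagram.row]

theorem card_colOf (lam : Nat.Partition n) (k : ℕ) :
    #{i : Fin n | colOf lam i = k} = (diagram lam).colLen k := by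
  rw [show #{i : Fin n | colOf lam i = k} = _ from card_filter_tableau lam fun c => c.2 = k,
    YoungDiagram.colLen_eq_card, YoungDiagram.col]

theorem colOf_lt_rowLen (lam : Nat.Partition n) (i : Fin n) :
    colOf lam i < (diagram lam).rowLen (rowOf lam i) :=
  YoungDiagram.mem_iff_lt_rowLen.1 ((YoungDiagram.mem_cells _).1 ((tableau lam).symm i).2)

theorem rowOf_colOf_injective (lam : Nat.Partition n) :
    Function.Injective fun i => (rowOf lam i, colOf lam i) := fun _ _ h =>
  (tableau lam).symm.injective (Subtype.ext h)

theorem colWeight_succ (lam : Nat.Partition n) (m : ℕ) :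
    colWeight lam (m + 1) = colWeight lam m + (diagram lam).colLen m := by
  rw [colWeight_eq, colWeight_eq, ← card_colOf, ← Finset.card_union_of_disjoint]
  · congr 1
    ext i
    simp [le_iff_lt_or_eq]
  · rw [Finset.disjoint_left]
    intro i hi hi'
    simp only [Finset.mem_filter, Finset.mem_univ, true_and] at hi hi'
    omega

theorem sort_parts_pos (lam : Nat.Partition n) : ∀ x ∈ lam.parts.sort (· ≥ ·), 0 < x :=
  fun _ hx => lam.parts_pos ((Multiset.mem_sort _).1 hx)

theorem rowLens_diagram (lam : Nat.Partition n) :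
    (diagram lam).rowLens = lam.parts.sort (· ≥ ·) :=
  YoungDiagram.rowLens_ofRowLens_eq_self (sort_parts_pos lam)

theorem diagram_injective : Function.Injective (diagram (n := n)) := by
  intro lam mu h
  apply Nat.Partition.ext
  rw [← Multiset.sort_eq lam.parts (· ≥ ·), ← Multiset.sort_eq mu.parts (· ≥ ·),
    ← rowLens_diagram, ← rowLens_diagram, h]

/-- Successive differences of `colWeight` are the column lengths, which determine the diagram. This
makes the pointwise order on `colWeight` usable as a partial order on partitions. -/
theorem colWeight_injective : Function.Injective (colWeight (n := n)) := by
  intro lam mu h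
  apply diagram_injective
  ext ⟨i, j⟩
  have h1 := colWeight_succ lam j
  have h2 := colWeight_succ mu j
  rw [h] at h1
  rw [YoungDiagram.mem_cells, YoungDiagram.mem_cells, YoungDiagram.mem_iff_lt_colLen,
    YoungDiagram.mem_iff_lt_colLen]
  omega

variable (lam nu : Nat.Partition n) (g : Equiv.Perm (Fin n))

theorem card_colOf_perm_lt (m : ℕ) :
    #{i : Fin n | colOf lam (g⁻¹ i) < m} = colWeight lam m := by
  rw [colWeight_eq]
  refine Finset.card_bij (fun i _ => g⁻¹ i) ?_ ?_ ?_
  · intro i hi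
    simpa using hi
  · intro i _ j _ h
    exact g⁻¹.injective h
  · intro j hj
    exact ⟨g j, by simpa using hj, by simp⟩

/-- Within one row the permuted column indices are distinct, so at most `m` of them lie below `m`;
the unpermuted tableau attains the maximum `min (rowLen k) m`. -/
theorem card_row_perm_lt_le
    (h : Function.Injective fun i => (rowOf nu i, colOf lam (g⁻¹ i))) (k m : ℕ) :
    #{i : Fin n | rowOf nu i = k ∧ colOf lam (g⁻¹ i) < m} ≤
      #{i : Fin n | rowOf nu i = k ∧ colOf nu i < m} := by
  rw [card_rowOf_colOf_lt, le_min_iff]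
  constructor
  · rw [← card_rowOf]
    exact Finset.card_le_card fun i => by simp +contextual
  · calc _ ≤ #(range m) := by
          refine Finset.card_le_card_of_injOn (fun i => colOf lam (g⁻¹ i)) ?_ ?_
          · intro i hi
            simp only [Finset.coe_filter, Finset.mem_univ, true_and, Set.mem_ofPred_eq] at hi
            simpa using hi.2
          · intro i hi j hj hij
            simp only [Finset.coe_filter, Finset.mem_univ, true_and, Set.mem_ofPred_eq] at hi hj
            exact h (Prod.ext (hi.1.trans hj.1.symm) hij)
      _ = m := Finset.card_range m

theorem card_filter_eq_sum_rowOf (P : Fin n → Prop) [DecidablePred P] :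
    #{i : Fin n | P i} = ∑ k ∈ univ.image (rowOf nu), #{i : Fin n | rowOf nu i = k ∧ P i} := by
  rw [Finset.card_eq_sum_card_fiberwise (f := rowOf nu) (t := univ.image (rowOf nu))
    (fun i _ => by simp)]
  refine Finset.sum_congr rfl fun k _ => ?_
  congr 1
  ext i
  simp [and_comm]

/-- If the rows of `nu` meet the columns of the permuted tableau `lam` in at most one entry each,
then `nu` is dominated by `lam`. -/
theorem colWeight_le_of_injective
    (h : Function.Injective fun i => (rowOf nu i, colOf lam (g⁻¹ i))) :
    colWeight lam ≤ colWeight nu := by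
  intro m
  rw [← card_colOf_perm_lt lam g, colWeight_eq, card_filter_eq_sum_rowOf nu,
    card_filter_eq_sum_rowOf nu]
  exact Finset.sum_le_sum fun k _ => card_row_perm_lt_le lam nu g h k m

/-- In the situation of equal shapes, the permuted columns stay inside the diagram. -/
theorem colOf_perm_lt_rowLen
    (h : Function.Injective fun i => (rowOf lam i, colOf lam (g⁻¹ i))) (i : Fin n) :
    colOf lam (g⁻¹ i) < (diagram lam).rowLen (rowOf lam i) := by
  set m := (diagram lam).rowLen (rowOf lam i) with hm
  -- For equal shapes both totals are `colWeight lam m`, so the rowwise inequalities are all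
  -- equalities; for `m` the length of the row of `i` this says that the whole row lands in the
  -- first `m` columns.
  have hsum : ∑ k ∈ univ.image (rowOf lam), #{i : Fin n | rowOf lam i = k ∧ colOf lam (g⁻¹ i) < m}
      = ∑ k ∈ univ.image (rowOf lam), #{i : Fin n | rowOf lam i = k ∧ colOf lam i < m} := by
    rw [← card_filter_eq_sum_rowOf, ← card_filter_eq_sum_rowOf, card_colOf_perm_lt, colWeight_eq]
  have heq := (Finset.sum_eq_sum_iff_of_le
    fun k _ => card_row_perm_lt_le lam lam g h k m).1 hsum (rowOf lam i) (by simp)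
  rw [card_rowOf_colOf_lt, ← hm, min_self, hm, ← card_rowOf] at heq
  have hsub := Finset.eq_of_subset_of_card_le
    (s := ({j : Fin n | rowOf lam j = rowOf lam i ∧ colOf lam (g⁻¹ j) < m} : Finset (Fin n)))
    (t := {j : Fin n | rowOf lam j = rowOf lam i}) (fun j => by simp +contextual) (by
      rw [hm, ← card_rowOf, heq])
  have : i ∈ ({j : Fin n | rowOf lam j = rowOf lam i} : Finset (Fin n)) := by simp
  rw [← hsub] at this
  simpa using this

/-- A permutation `g` whose permuted columns meet each row at most once is a product of a row
permutation and a column permutation. -/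
theorem exists_row_mul_col
    (h : Function.Injective fun i => (rowOf lam i, colOf lam (g⁻¹ i))) :
    ∃ p q : Equiv.Perm (Fin n), (∀ i, rowOf lam (p i) = rowOf lam i) ∧
      (∀ i, colOf lam (q i) = colOf lam i) ∧ g = p * q := by
  have hmem : ∀ i, (rowOf lam i, colOf lam (g⁻¹ i)) ∈ (diagram lam).cells := fun i =>
    (YoungDiagram.mem_cells _).2
      (YoungDiagram.mem_iff_lt_rowLen.2 (colOf_perm_lt_rowLen lam g h i))
  -- Within its row, each entry is moved to the column it has in the permuted tableau. This is a row
  -- permutation `p`, and `p * g` then preserves columns.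
  set f : Fin n → Fin n := fun i => tableau lam ⟨_, hmem i⟩ with hf
  have hinj : Function.Injective f := fun i j hij =>
    h (congrArg Subtype.val ((tableau lam).injective hij))
  set p := Equiv.ofBijective f (Finite.injective_iff_bijective.1 hinj) with hp
  have hrow : ∀ i, rowOf lam (p i) = rowOf lam i := fun i => by simp [hp, hf, rowOf]
  have hcol : ∀ i, colOf lam (p i) = colOf lam (g⁻¹ i) := fun i => by simp [hp, hf, colOf]
  refine ⟨p⁻¹, p * g, fun i => ?_, fun i => ?_, by group⟩
  · simpa using (hrow (p⁻¹ i)).symm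
  · rw [Equiv.Perm.mul_apply, hcol]
    simp

end Counting

/-! ### Row and column symmetrizers in the group algebra -/

section YoungSymmetrizer

variable {n : ℕ} (lam nu : Nat.Partition n)

/-- The group algebra of the symmetric group. -/
abbrev GroupAlg (n : ℕ) := MonoidAlgebra ℂ (Equiv.Perm (Fin n))

/-- The number of permutations preserving the rows. -/
noncomputable def rowCard : ℕ :=
  #{σ : Equiv.Perm (Fin n) | ∀ i, rowOf lam (σ i) = rowOf lam i}

/-- The number of permutations preserving the columns. -/
noncomputable def colCard : ℕ :=
  #{σ : Equiv.Perm (Fin n) | ∀ i, colOf lam (σ i) = colOf lam i}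

theorem rowCard_ne_zero : rowCard lam ≠ 0 :=
  Finset.card_ne_zero.2 ⟨1, by simp⟩

theorem colCard_ne_zero : colCard lam ≠ 0 :=
  Finset.card_ne_zero.2 ⟨1, by simp⟩

variable {lam} in
theorem of_mul_rowSymmetrizer {p : Equiv.Perm (Fin n)} (hp : ∀ i, rowOf lam (p i) = rowOf lam i) :
    MonoidAlgebra.of ℂ _ p * rowSymmetrizer lam = rowSymmetrizer lam := by
  rw [rowSymmetrizer, Finset.mul_sum]
  refine Finset.sum_equiv (Equiv.mulLeft p) (fun σ => ?_) fun σ _ => ?_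
  · simp [hp]
  · rw [← map_mul]; rfl

variable {lam} in
theorem rowSymmetrizer_mul_of {p : Equiv.Perm (Fin n)} (hp : ∀ i, rowOf lam (p i) = rowOf lam i) :
    rowSymmetrizer lam * MonoidAlgebra.of ℂ _ p = rowSymmetrizer lam := by
  rw [rowSymmetrizer, Finset.sum_mul]
  refine Finset.sum_equiv (Equiv.mulRight p) (fun σ => ?_) fun σ _ => ?_
  · simp only [Finset.mem_filter, Finset.mem_univ, true_and, Equiv.coe_mulRight,
      Equiv.Perm.mul_apply]
    refine ⟨fun h i => (h (p i)).trans (hp i), fun h i => ?_⟩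
    have h1 := h (p⁻¹ i)
    have h2 := hp (p⁻¹ i)
    simp only [Equiv.Perm.coe_inv, Equiv.apply_symm_apply] at h1 h2
    rw [h1, ← h2]
  · rw [← map_mul]; rfl

theorem sign_mul_sign_complex (q : Equiv.Perm (Fin n)) :
    ((Equiv.Perm.sign q : ℤ) : ℂ) * ((Equiv.Perm.sign q : ℤ) : ℂ) = 1 := by
  rw [← Int.cast_mul]
  simp

variable {lam} in
theorem of_mul_colAntisymmetrizer {q : Equiv.Perm (Fin n)}
    (hq : ∀ i, colOf lam (q i) = colOf lam i) :
    MonoidAlgebra.of ℂ _ q * colAntisymmetrizer lam =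
      ((Equiv.Perm.sign q : ℤ) : ℂ) • colAntisymmetrizer lam := by
  rw [colAntisymmetrizer, Finset.mul_sum, Finset.smul_sum]
  refine Finset.sum_equiv (Equiv.mulLeft q) (fun σ => ?_) fun σ _ => ?_
  · simp [hq]
  · rw [mul_smul_comm, ← map_mul, smul_smul, Equiv.coe_mulLeft, Equiv.Perm.sign_mul]
    push_cast
    rw [← mul_assoc, sign_mul_sign_complex, one_mul]

variable {lam} in
theorem rowSymmetrizer_mul_self :
    rowSymmetrizer lam * rowSymmetrizer lam = (rowCard lam : ℂ) • rowSymmetrizer lam := by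
  conv_lhs => enter [1]; rw [rowSymmetrizer]
  rw [Finset.sum_mul, Finset.sum_congr rfl fun σ hσ =>
    of_mul_rowSymmetrizer (by simpa using hσ), Finset.sum_const, rowCard, Nat.cast_smul_eq_nsmul]

theorem colAntisymmetrizer_mul_self :
    colAntisymmetrizer lam * colAntisymmetrizer lam =
      (colCard lam : ℂ) • colAntisymmetrizer lam := by
  conv_lhs => enter [1]; rw [colAntisymmetrizer]
  rw [Finset.sum_mul, Finset.sum_congr rfl fun σ hσ => by
    rw [smul_mul_assoc, of_mul_colAntisymmetrizer (by simpa using hσ), smul_smul,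
      sign_mul_sign_complex, one_smul], Finset.sum_const, colCard, Nat.cast_smul_eq_nsmul]

/-- Two entries in one row of `nu` and one column of the permuted tableau `lam` kill the product. -/
theorem row_mul_of_mul_col_eq_zero_of_not_injective (g : Equiv.Perm (Fin n))
    (h : ¬ Function.Injective fun i => (rowOf nu i, colOf lam (g⁻¹ i))) :
    rowSymmetrizer nu * MonoidAlgebra.of ℂ _ g * colAntisymmetrizer lam = 0 := by
  simp only [Function.Injective, not_forall, Prod.mk.injEq] at h
  obtain ⟨i, j, ⟨hr, hc⟩, hij⟩ := h
  have hτ : ∀ k, rowOf nu (Equiv.swap i j k) = rowOf nu k := by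
    intro k
    by_cases h1 : k = i
    · rw [h1, Equiv.swap_apply_left, hr]
    · by_cases h2 : k = j
      · rw [h2, Equiv.swap_apply_right, hr]
      · rw [Equiv.swap_apply_of_ne_of_ne h1 h2]
  have hτ' : ∀ k, colOf lam ((g⁻¹ * Equiv.swap i j * g) k) = colOf lam k := by
    intro k
    simp only [Equiv.Perm.mul_apply]
    by_cases h1 : g k = i
    · rw [h1, Equiv.swap_apply_left, ← hc, ← h1]
      simp
    · by_cases h2 : g k = j
      · rw [h2, Equiv.swap_apply_right, hc, ← h2]
        simp
      · rw [Equiv.swap_apply_of_ne_of_ne h1 h2]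
        simp
  have hsign : Equiv.Perm.sign (g⁻¹ * Equiv.swap i j * g) = -1 := by
    rw [Equiv.Perm.sign_mul, Equiv.Perm.sign_mul, Equiv.Perm.sign_swap hij, Equiv.Perm.sign_inv,
      mul_comm (Equiv.Perm.sign g), mul_assoc, Int.units_mul_self, mul_one]
  -- The transposition is absorbed by the row symmetrizer on the left; moved past `g` it becomes a
  -- column transposition, absorbed on the right with sign `-1`.
  have key : rowSymmetrizer nu * MonoidAlgebra.of ℂ _ g * colAntisymmetrizer lam =
      -(rowSymmetrizer nu * MonoidAlgebra.of ℂ _ g * colAntisymmetrizer lam) := by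
    conv_lhs => rw [← rowSymmetrizer_mul_of hτ]
    rw [mul_assoc (rowSymmetrizer nu), ← map_mul, show Equiv.swap i j * g =
      g * (g⁻¹ * Equiv.swap i j * g) by group, map_mul, mul_assoc, mul_assoc,
      of_mul_colAntisymmetrizer hτ', hsign]
    simp [mul_assoc]
  have h2 : (2 : ℂ) • (rowSymmetrizer nu * MonoidAlgebra.of ℂ _ g * colAntisymmetrizer lam) = 0 := by
    rw [two_smul]
    exact add_eq_zero_iff_eq_neg.2 key
  exact (smul_eq_zero.1 h2).resolve_left two_ne_zero

theorem row_mul_mul_col_eq_zero (h : ¬ colWeight lam ≤ colWeight nu) (x : GroupAlg n) :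
    rowSymmetrizer nu * x * colAntisymmetrizer lam = 0 := by
  induction x using MonoidAlgebra.induction_linear with
  | zero => simp
  | add x y hx hy => rw [mul_add, add_mul, hx, hy, add_zero]
  | single g r =>
    have : MonoidAlgebra.single g r = r • MonoidAlgebra.of ℂ _ g := by simp
    rw [this, mul_smul_comm, smul_mul_assoc, row_mul_of_mul_col_eq_zero_of_not_injective lam nu g
      (fun hinj => h (colWeight_le_of_injective lam nu g hinj)), smul_zero]

/-- The Young symmetrizer. -/
noncomputable def youngSymmetrizer : GroupAlg n := rowSymmetrizer lam * colAntisymmetrizer lam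

theorem coeff_row_mul_of_mul_col (g h : Equiv.Perm (Fin n)) :
    (rowSymmetrizer lam * MonoidAlgebra.of ℂ _ g * colAntisymmetrizer lam).coeff h =
      ∑ p : Equiv.Perm (Fin n) with ∀ i, rowOf lam (p i) = rowOf lam i,
        ∑ q : Equiv.Perm (Fin n) with ∀ i, colOf lam (q i) = colOf lam i,
          if p * g * q = h then ((Equiv.Perm.sign q : ℤ) : ℂ) else 0 := by
  rw [rowSymmetrizer, colAntisymmetrizer, Finset.sum_mul, Finset.sum_mul_sum,
    MonoidAlgebra.coeff_sum, Finset.sum_apply']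
  refine Finset.sum_congr rfl fun p _ => ?_
  rw [MonoidAlgebra.coeff_sum, Finset.sum_apply']
  refine Finset.sum_congr rfl fun q _ => ?_
  rw [mul_smul_comm, ← map_mul, ← map_mul, MonoidAlgebra.coeff_smul_apply, MonoidAlgebra.of_apply,
    MonoidAlgebra.coeff_single, Finsupp.single_apply, smul_eq_mul, mul_ite, mul_one, mul_zero]

theorem coeff_youngSymmetrizer (h : Equiv.Perm (Fin n)) :
    (youngSymmetrizer lam).coeff h =
      ∑ p : Equiv.Perm (Fin n) with ∀ i, rowOf lam (p i) = rowOf lam i,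
        ∑ q : Equiv.Perm (Fin n) with ∀ i, colOf lam (q i) = colOf lam i,
          if p * q = h then ((Equiv.Perm.sign q : ℤ) : ℂ) else 0 := by
  have := coeff_row_mul_of_mul_col lam 1 h
  rw [map_one, mul_one] at this
  simp only [mul_one] at this
  exact this

/-- A permutation preserving both rows and columns is the identity, so only `p = q = 1` contributes.
Scalars multiplying the Young symmetrizer can therefore be read off at `1`. -/
theorem coeff_youngSymmetrizer_one : (youngSymmetrizer lam).coeff 1 = 1 := by
  rw [coeff_youngSymmetrizer, Finset.sum_eq_single 1, Finset.sum_eq_single 1]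
  · simp
  · intro q _ hq
    simp [hq]
  · simp
  · intro p hp hp1
    refine Finset.sum_eq_zero fun q hq => if_neg fun hpq => hp1 ?_
    simp only [Finset.mem_filter, Finset.mem_univ, true_and] at hp hq
    have hqp : p = q⁻¹ := eq_inv_of_mul_eq_one_left hpq
    ext1 i
    refine rowOf_colOf_injective lam (Prod.ext (hp i) ?_)
    have := hq (p i)
    rw [hqp] at this ⊢
    simpa using this.symm
  · simp

theorem youngSymmetrizer_ne_zero : youngSymmetrizer lam ≠ 0 := fun h => by
  have := coeff_youngSymmetrizer_one lam
  rw [h] at this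
  simp at this

theorem coeff_one_row_mul_of_mul_col (g : Equiv.Perm (Fin n)) :
    (rowSymmetrizer lam * MonoidAlgebra.of ℂ _ g * colAntisymmetrizer lam).coeff 1 =
      (youngSymmetrizer lam).coeff g := by
  rw [coeff_row_mul_of_mul_col, coeff_youngSymmetrizer]
  refine Finset.sum_equiv (Equiv.inv _) (fun p => ?_) fun p _ => ?_
  · simp only [Finset.mem_filter, Finset.mem_univ, true_and, Equiv.inv_apply]
    refine ⟨fun h i => ?_, fun h i => ?_⟩
    · simpa using (h (p⁻¹ i)).symm
    · simpa using (h (p i)).symm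
  · refine Finset.sum_equiv (Equiv.inv _) (fun q => ?_) fun q _ => ?_
    · simp only [Finset.mem_filter, Finset.mem_univ, true_and, Equiv.inv_apply]
      refine ⟨fun h i => ?_, fun h i => ?_⟩
      · simpa using (h (q⁻¹ i)).symm
      · simpa using (h (q i)).symm
    · simp only [Equiv.inv_apply, Equiv.Perm.sign_inv]
      refine if_congr ?_ rfl rfl
      rw [mul_assoc, mul_eq_one_iff_inv_eq, eq_mul_inv_iff_mul_eq.symm, inv_inv, eq_comm]

/-- Either `g` is a row permutation times a column permutation and is absorbed up to sign, or the
product vanishes. In both cases a multiple of the symmetrizer results, and comparing coefficients at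
`1` identifies the scalar. -/
theorem row_mul_of_mul_col (g : Equiv.Perm (Fin n)) :
    rowSymmetrizer lam * MonoidAlgebra.of ℂ _ g * colAntisymmetrizer lam =
      (youngSymmetrizer lam).coeff g • youngSymmetrizer lam := by
  obtain ⟨k, hk⟩ : ∃ k : ℂ, rowSymmetrizer lam * MonoidAlgebra.of ℂ _ g * colAntisymmetrizer lam =
      k • youngSymmetrizer lam := by
    by_cases h : Function.Injective fun i => (rowOf lam i, colOf lam (g⁻¹ i))
    · obtain ⟨p, q, hp, hq, rfl⟩ := exists_row_mul_col lam g h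
      refine ⟨((Equiv.Perm.sign q : ℤ) : ℂ), ?_⟩
      rw [map_mul, ← mul_assoc, rowSymmetrizer_mul_of hp, mul_assoc,
        of_mul_colAntisymmetrizer hq, mul_smul_comm]
      rfl
    · exact ⟨0, by rw [row_mul_of_mul_col_eq_zero_of_not_injective lam lam g h, zero_smul]⟩
  have := coeff_one_row_mul_of_mul_col lam g
  rw [hk, MonoidAlgebra.coeff_smul_apply, coeff_youngSymmetrizer_one, smul_eq_mul, mul_one] at this
  rw [hk, this]

theorem exists_row_mul_mul_col (x : GroupAlg n) :
    ∃ k : ℂ, rowSymmetrizer lam * x * colAntisymmetrizer lam = k • youngSymmetrizer lam := by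
  induction x using MonoidAlgebra.induction_linear with
  | zero => exact ⟨0, by simp⟩
  | add x y hx hy =>
    obtain ⟨k, hk⟩ := hx
    obtain ⟨l, hl⟩ := hy
    exact ⟨k + l, by rw [mul_add, add_mul, hk, hl, add_smul]⟩
  | single g r =>
    have : MonoidAlgebra.single g r = r • MonoidAlgebra.of ℂ _ g := by simp
    exact ⟨r * (youngSymmetrizer lam).coeff g, by
      rw [this, mul_smul_comm, smul_mul_assoc, row_mul_of_mul_col, smul_smul]⟩

end YoungSymmetrizer

/-! ### Traces on Specht modules -/

section Trace

variable {n : ℕ} (lam nu : Nat.Partition n)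

/-- The anti-automorphism of the group algebra inverting permutations, as a homomorphism to the
opposite algebra. -/
noncomputable def invHom (n : ℕ) : GroupAlg n →ₐ[ℂ] (GroupAlg n)ᵐᵒᵖ :=
  MonoidAlgebra.lift ℂ _ _
    { toFun := fun g => MulOpposite.op (MonoidAlgebra.of ℂ _ g⁻¹)
      map_one' := by rw [inv_one, map_one, MulOpposite.op_one]
      map_mul' := fun g h => by rw [mul_inv_rev, map_mul, MulOpposite.op_mul] }

/-- The anti-automorphism of the group algebra inverting permutations. -/
noncomputable def invAnti (x : GroupAlg n) : GroupAlg n := (invHom n x).unop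

theorem invAnti_of (g : Equiv.Perm (Fin n)) :
    invAnti (MonoidAlgebra.of ℂ _ g) = MonoidAlgebra.of ℂ _ g⁻¹ := by
  simp [invAnti, invHom]

theorem invAnti_smul (r : ℂ) (x : GroupAlg n) : invAnti (r • x) = r • invAnti x := by
  simp [invAnti]

theorem invAnti_mul (x y : GroupAlg n) : invAnti (x * y) = invAnti y * invAnti x := by
  simp [invAnti]

theorem invAnti_zero : invAnti (0 : GroupAlg n) = 0 := by
  simp [invAnti]

theorem invAnti_sum {ι : Type*} (s : Finset ι) (f : ι → GroupAlg n) :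
    invAnti (∑ i ∈ s, f i) = ∑ i ∈ s, invAnti (f i) := by
  simp [invAnti]

theorem single_eq_smul_of (g : Equiv.Perm (Fin n)) (r : ℂ) :
    MonoidAlgebra.single g r = r • MonoidAlgebra.of ℂ _ g := by simp

theorem sum_coeff_smul_of (x : GroupAlg n) :
    ∑ g, x.coeff g • MonoidAlgebra.of ℂ _ g = x := by
  conv_rhs => rw [← MonoidAlgebra.sum_coeff_single x, Finsupp.sum_fintype _ _ (by simp)]
  exact Finset.sum_congr rfl fun g _ => (single_eq_smul_of g _).symm

theorem invAnti_invAnti (x : GroupAlg n) : invAnti (invAnti x) = x := by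
  conv_lhs => rw [← sum_coeff_smul_of x]
  rw [invAnti_sum, invAnti_sum]
  conv_rhs => rw [← sum_coeff_smul_of x]
  refine Finset.sum_congr rfl fun g _ => ?_
  rw [invAnti_smul, invAnti_smul, invAnti_of, invAnti_of, inv_inv]

theorem invAnti_rowSymmetrizer : invAnti (rowSymmetrizer lam) = rowSymmetrizer lam := by
  rw [rowSymmetrizer, invAnti_sum]
  refine Finset.sum_equiv (Equiv.inv _) (fun p => ?_) fun p _ => invAnti_of p
  simp only [Finset.mem_filter, Finset.mem_univ, true_and, Equiv.inv_apply]
  refine ⟨fun h i => ?_, fun h i => ?_⟩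
  · simpa using (h (p⁻¹ i)).symm
  · simpa using (h (p i)).symm

theorem invAnti_colAntisymmetrizer : invAnti (colAntisymmetrizer lam) = colAntisymmetrizer lam := by
  rw [colAntisymmetrizer, invAnti_sum]
  refine Finset.sum_equiv (Equiv.inv _) (fun p => ?_) fun p _ => ?_
  · simp only [Finset.mem_filter, Finset.mem_univ, true_and, Equiv.inv_apply]
    refine ⟨fun h i => ?_, fun h i => ?_⟩
    · simpa using (h (p⁻¹ i)).symm
    · simpa using (h (p i)).symm
  · rw [invAnti_smul, invAnti_of, Equiv.inv_apply, Equiv.Perm.sign_inv]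

/-- The image of `row_mul_mul_col_eq_zero` under the anti-automorphism, which fixes both
symmetrizers and reverses products. -/
theorem col_mul_mul_row_eq_zero (h : ¬ colWeight nu ≤ colWeight lam) (x : GroupAlg n) :
    colAntisymmetrizer nu * x * rowSymmetrizer lam = 0 := by
  have h1 : invAnti (colAntisymmetrizer nu * x * rowSymmetrizer lam) = 0 := by
    rw [invAnti_mul, invAnti_mul, invAnti_rowSymmetrizer, invAnti_colAntisymmetrizer, ← mul_assoc,
      row_mul_mul_col_eq_zero nu lam h]
  rw [← invAnti_invAnti (colAntisymmetrizer nu * x * rowSymmetrizer lam), h1, invAnti_zero]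

theorem col_mul_of_mul_row (g : Equiv.Perm (Fin n)) :
    colAntisymmetrizer lam * MonoidAlgebra.of ℂ _ g * rowSymmetrizer lam =
      (youngSymmetrizer lam).coeff g⁻¹ • (colAntisymmetrizer lam * rowSymmetrizer lam) := by
  have h1 : invAnti (colAntisymmetrizer lam * MonoidAlgebra.of ℂ _ g * rowSymmetrizer lam) =
      (youngSymmetrizer lam).coeff g⁻¹ • youngSymmetrizer lam := by
    rw [invAnti_mul, invAnti_mul, invAnti_rowSymmetrizer, invAnti_colAntisymmetrizer, ← mul_assoc,
      invAnti_of, row_mul_of_mul_col]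
  rw [← invAnti_invAnti (colAntisymmetrizer lam * _ * rowSymmetrizer lam), h1, invAnti_smul,
    youngSymmetrizer, invAnti_mul, invAnti_rowSymmetrizer, invAnti_colAntisymmetrizer]

/-- The trace of an element of the group algebra on the Specht module. -/
noncomputable def spechtTrace : GroupAlg n →ₗ[ℂ] ℂ :=
  LinearMap.trace ℂ (spechtModule lam) ∘ₗ
    (Algebra.lsmul ℂ ℂ (spechtModule lam) : GroupAlg n →ₐ[ℂ] _).toLinearMap

theorem spechtTrace_apply (x : GroupAlg n) : spechtTrace lam x =
    LinearMap.trace ℂ (spechtModule lam) (Algebra.lsmul ℂ ℂ (spechtModule lam) x) := rfl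

theorem spechtTrace_of (g : Equiv.Perm (Fin n)) :
    spechtTrace lam (MonoidAlgebra.of ℂ _ g) = (spechtRep lam).character g := rfl

theorem spechtTrace_rowSymmetrizer : spechtTrace lam (rowSymmetrizer nu) =
    ∑ σ : Equiv.Perm (Fin n) with ∀ i, rowOf nu (σ i) = rowOf nu i,
      (spechtRep lam).character σ := by
  rw [rowSymmetrizer, map_sum]
  rfl

theorem spechtTrace_colAntisymmetrizer : spechtTrace lam (colAntisymmetrizer nu) =
    ∑ σ : Equiv.Perm (Fin n) with ∀ i, colOf nu (σ i) = colOf nu i,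
      ((Equiv.Perm.sign σ : ℤ) : ℂ) * (spechtRep lam).character σ := by
  rw [colAntisymmetrizer, map_sum]
  refine Finset.sum_congr rfl fun σ _ => ?_
  rw [map_smul, spechtTrace_of, smul_eq_mul]

theorem exists_eq_mul_young (v : spechtModule lam) :
    ∃ y : GroupAlg n, (v : GroupAlg n) = y * rowSymmetrizer lam * colAntisymmetrizer lam := by
  obtain ⟨y, hy⟩ := Ideal.mem_span_singleton'.1 v.2
  exact ⟨y, by rw [← hy, mul_assoc]⟩

theorem spechtTrace_eq_zero {x : GroupAlg n}
    (h : ∀ y, x * y * rowSymmetrizer lam * colAntisymmetrizer lam = 0) : spechtTrace lam x = 0 := by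
  rw [spechtTrace_apply]
  convert map_zero (LinearMap.trace ℂ (spechtModule lam))
  ext v
  obtain ⟨y, hy⟩ := exists_eq_mul_young lam v
  simp [hy, ← mul_assoc, h]

theorem spechtTrace_rowSymmetrizer_eq_zero (h : ¬ colWeight lam ≤ colWeight nu) :
    spechtTrace lam (rowSymmetrizer nu) = 0 :=
  spechtTrace_eq_zero lam fun y => by
    rw [mul_assoc (rowSymmetrizer nu), row_mul_mul_col_eq_zero lam nu h]

theorem spechtTrace_colAntisymmetrizer_eq_zero (h : ¬ colWeight nu ≤ colWeight lam) :
    spechtTrace lam (colAntisymmetrizer nu) = 0 :=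
  spechtTrace_eq_zero lam fun y => by
    rw [col_mul_mul_row_eq_zero lam nu h, zero_mul]

/-- With `a` the row symmetrizer and `c` the Young symmetrizer, `a` sends every `v` of the module to
a multiple of `c`, namely by the coefficient of `a v` at `1`. The trace of this rank-one map is the
coefficient of `a c = rowCard • c` at `1`. -/
theorem spechtTrace_rowSymmetrizer_self : spechtTrace lam (rowSymmetrizer lam) = rowCard lam := by
  let c : spechtModule lam := ⟨youngSymmetrizer lam, Ideal.subset_span rfl⟩
  let f : spechtModule lam →ₗ[ℂ] ℂ :=
    { toFun := fun v => (rowSymmetrizer lam * (v : GroupAlg n)).coeff 1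
      map_add' := fun v w => by simp [mul_add]
      map_smul' := fun r v => by simp }
  have hf : Algebra.lsmul ℂ ℂ (spechtModule lam) (rowSymmetrizer lam) = f.smulRight c := by
    refine LinearMap.ext fun v => Subtype.ext ?_
    obtain ⟨y, hy⟩ := exists_eq_mul_young lam v
    obtain ⟨k, hk⟩ := exists_row_mul_mul_col lam (y * rowSymmetrizer lam)
    rw [mul_assoc, ← hy] at hk
    have hfv : f v = k := by
      change (rowSymmetrizer lam * (v : GroupAlg n)).coeff 1 = k
      rw [hk, MonoidAlgebra.coeff_smul_apply, coeff_youngSymmetrizer_one, smul_eq_mul, mul_one]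
    change rowSymmetrizer lam * (v : GroupAlg n) = f v • youngSymmetrizer lam
    rw [hfv, hk]
  rw [spechtTrace_apply, hf, LinearMap.trace_smulRight]
  change (rowSymmetrizer lam * youngSymmetrizer lam).coeff 1 = _
  rw [youngSymmetrizer, ← mul_assoc, rowSymmetrizer_mul_self, smul_mul_assoc,
    MonoidAlgebra.coeff_smul_apply]
  change _ • (youngSymmetrizer lam).coeff 1 = _
  rw [coeff_youngSymmetrizer_one, smul_eq_mul, mul_one]

/-! ### The Frobenius–Schur indicator of a Specht module -/

/-- The trace of right multiplication by `c` is computed twice. On the basis of permutations each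
diagonal entry is the coefficient of `c` at `1`; on the other hand the map has values in the Specht
module and acts there as the scalar `k`. -/
theorem exists_young_mul_self :
    ∃ k : ℂ, youngSymmetrizer lam * youngSymmetrizer lam = k • youngSymmetrizer lam ∧
      k * Module.finrank ℂ (spechtModule lam) = n.factorial := by
  obtain ⟨k, hk⟩ := exists_row_mul_mul_col lam (colAntisymmetrizer lam * rowSymmetrizer lam)
  have hk' : youngSymmetrizer lam * youngSymmetrizer lam = k • youngSymmetrizer lam := by
    rw [← hk]
    simp only [youngSymmetrizer, mul_assoc]
  refine ⟨k, hk', ?_⟩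
  let p : Submodule ℂ (GroupAlg n) := (spechtModule lam).restrictScalars ℂ
  let f : GroupAlg n →ₗ[ℂ] GroupAlg n := LinearMap.mulRight ℂ (youngSymmetrizer lam)
  have hf : ∀ x, f x ∈ p := fun x => Ideal.mul_mem_left _ x (Ideal.subset_span rfl)
  have h1 := LinearMap.trace_restrict_eq_of_forall_mem p f hf
  have h2 : f.restrict (fun x _ => hf x) = k • (LinearMap.id : p →ₗ[ℂ] p) := by
    refine LinearMap.ext fun v => Subtype.ext ?_
    obtain ⟨y, hy⟩ := exists_eq_mul_young lam v
    change (v : GroupAlg n) * youngSymmetrizer lam = k • (v : GroupAlg n)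
    rw [hy, mul_assoc y, mul_assoc, ← mul_smul_comm]
    exact congrArg (y * ·) hk'
  have h3 : LinearMap.trace ℂ _ f = n.factorial := by
    rw [LinearMap.trace_eq_matrix_trace ℂ (MonoidAlgebra.basis (Equiv.Perm (Fin n)) ℂ),
      Matrix.trace]
    have : ∀ g : Equiv.Perm (Fin n), (LinearMap.toMatrix (MonoidAlgebra.basis _ ℂ)
        (MonoidAlgebra.basis _ ℂ) f).diag g = 1 := by
      intro g
      rw [Matrix.diag_apply, LinearMap.toMatrix_apply]
      change (MonoidAlgebra.single g 1 * youngSymmetrizer lam).coeff g = 1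
      rw [MonoidAlgebra.coeff_single_mul_apply, inv_mul_cancel, coeff_youngSymmetrizer_one, mul_one]
    rw [Finset.sum_congr rfl fun g _ => this g]
    simp [Fintype.card_perm]
  rw [h2, h3, map_smul, LinearMap.trace_id, smul_eq_mul] at h1
  exact h1

/-- The sum of all squares in the group algebra. -/
noncomputable def sumSquares (n : ℕ) : GroupAlg n :=
  ∑ h : Equiv.Perm (Fin n), MonoidAlgebra.of ℂ _ (h * h)

theorem of_mul_sumSquares (g : Equiv.Perm (Fin n)) :
    MonoidAlgebra.of ℂ _ g * sumSquares n = sumSquares n * MonoidAlgebra.of ℂ _ g := by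
  rw [sumSquares, Finset.mul_sum, Finset.sum_mul]
  refine Finset.sum_equiv (MulAut.conj g).toEquiv (by simp) fun h _ => ?_
  rw [← map_mul, ← map_mul]
  congr 1
  simp [MulAut.conj_apply, mul_assoc]

theorem mul_sumSquares (x : GroupAlg n) : x * sumSquares n = sumSquares n * x := by
  rw [← sum_coeff_smul_of x, Finset.mul_sum, Finset.sum_mul]
  exact Finset.sum_congr rfl fun g _ => by
    rw [smul_mul_assoc, mul_smul_comm, of_mul_sumSquares]

/-- For `x = g` substitute `h ↦ g h`: then `h g h = g⁻¹ (g h)²`. This brings the squares into the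
computation of the indicator. -/
theorem sum_of_mul_mul_of (x : GroupAlg n) :
    ∑ h : Equiv.Perm (Fin n), MonoidAlgebra.of ℂ _ h * x * MonoidAlgebra.of ℂ _ h =
      invAnti x * sumSquares n := by
  have hof : ∀ g : Equiv.Perm (Fin n), ∑ h : Equiv.Perm (Fin n), MonoidAlgebra.of ℂ _ h *
      MonoidAlgebra.of ℂ _ g * MonoidAlgebra.of ℂ _ h =
      MonoidAlgebra.of ℂ _ g⁻¹ * sumSquares n := by
    intro g
    rw [sumSquares, Finset.mul_sum]
    refine Finset.sum_equiv (Equiv.mulLeft g) (by simp) fun h _ => ?_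
    rw [← map_mul, ← map_mul, ← map_mul]
    congr 1
    simp [mul_assoc]
  conv_rhs => rw [← sum_coeff_smul_of x, invAnti_sum, Finset.sum_mul]
  conv_lhs => enter [2, h]; rw [← sum_coeff_smul_of x, Finset.mul_sum, Finset.sum_mul]
  rw [Finset.sum_comm]
  refine Finset.sum_congr rfl fun g _ => ?_
  rw [invAnti_smul, invAnti_of, smul_mul_assoc, ← hof g, Finset.smul_sum]
  exact Finset.sum_congr rfl fun h _ => by rw [mul_smul_comm, smul_mul_assoc]

theorem young_mul_of_mul_young (h : Equiv.Perm (Fin n)) :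
    youngSymmetrizer lam * MonoidAlgebra.of ℂ _ h * youngSymmetrizer lam =
      (youngSymmetrizer lam).coeff h⁻¹ • (youngSymmetrizer lam * youngSymmetrizer lam) := by
  have := congrArg (fun x => rowSymmetrizer lam * x * colAntisymmetrizer lam)
    (col_mul_of_mul_row lam h)
  simp only [mul_smul_comm, smul_mul_assoc] at this
  simpa only [youngSymmetrizer, mul_assoc] using this

/-- The Frobenius–Schur indicator of a Specht module is one. -/
theorem sum_character_sq :
    ∑ h : Equiv.Perm (Fin n), (spechtRep lam).character (h * h) = n.factorial := by
  obtain ⟨N, hN, hdim⟩ := exists_young_mul_self lam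
  set a := rowSymmetrizer lam with ha
  set b := colAntisymmetrizer lam with hb
  set c := youngSymmetrizer lam with hc
  have hcab : c = a * b := rfl
  have hN0 : N ≠ 0 := by
    rintro rfl
    rw [zero_mul] at hdim
    exact n.factorial_ne_zero (by exact_mod_cast hdim.symm)
  -- The sum of squares is central, so it acts on `c = a b` by a scalar `k`. The goal is `k = N`,
  -- where `c² = N c`; this follows from evaluating `c · ∑ h c h` in two ways.
  obtain ⟨k, hk⟩ := exists_row_mul_mul_col lam (sumSquares n)
  have hkc : sumSquares n * c = k • c := by
    rw [← hk, ← ha, ← hb, mul_sumSquares a, mul_assoc, hcab]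
  have hinv : invAnti c = b * a := by
    rw [hcab, invAnti_mul, ha, hb, invAnti_rowSymmetrizer, invAnti_colAntisymmetrizer]
  have hbb : b * b = (colCard lam : ℂ) • b := colAntisymmetrizer_mul_self lam
  have habba : c * (b * a) = (colCard lam : ℂ) • (c * a) := by
    rw [hcab, ← mul_assoc, mul_assoc a b b, hbb, mul_smul_comm, smul_mul_assoc]
  -- First evaluation: `∑ h c h` is `b a` times the sum of squares.
  have e1 : c * ∑ h, MonoidAlgebra.of ℂ _ h * c * MonoidAlgebra.of ℂ _ h =
      (colCard lam : ℂ) • k • (c * a) := by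
    rw [sum_of_mul_mul_of, hinv, ← mul_assoc, habba, smul_mul_assoc, mul_sumSquares, ← mul_assoc,
      hkc, smul_mul_assoc]
  -- Second evaluation: `c h c` is the coefficient of `c` at `h⁻¹` times `c²`, so summing over `h`
  -- gives `c²` times the inverted `c`, which is `b a`.
  have e2 : c * ∑ h, MonoidAlgebra.of ℂ _ h * c * MonoidAlgebra.of ℂ _ h =
      (colCard lam : ℂ) • N • (c * a) := by
    have : ∀ h : Equiv.Perm (Fin n), c * (MonoidAlgebra.of ℂ _ h * c * MonoidAlgebra.of ℂ _ h) =
        c * c * (c.coeff h⁻¹ • MonoidAlgebra.of ℂ _ h) := by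
      intro h
      rw [← mul_assoc, ← mul_assoc, young_mul_of_mul_young, smul_mul_assoc, mul_smul_comm]
    rw [Finset.mul_sum, Finset.sum_congr rfl fun h _ => this h, ← Finset.mul_sum]
    have hsum : ∑ h : Equiv.Perm (Fin n), c.coeff h⁻¹ • MonoidAlgebra.of ℂ _ h = invAnti c := by
      conv_rhs => rw [← sum_coeff_smul_of c, invAnti_sum]
      refine Finset.sum_equiv (Equiv.inv _) (by simp) fun h _ => ?_
      rw [invAnti_smul, invAnti_of, Equiv.inv_apply, inv_inv]
    rw [hsum, hinv, hN, smul_mul_assoc, habba, smul_comm]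
  -- Otherwise `c² = (c a) b` would vanish, although it equals `N c` with `N ≠ 0`.
  have hca : c * a ≠ 0 := by
    intro h0
    have : c * c = 0 := by
      conv_lhs => rw [hcab, ← mul_assoc, ← hcab, h0, zero_mul]
    rw [hN] at this
    exact (smul_ne_zero hN0 (youngSymmetrizer_ne_zero lam)) this
  have hkN : k = N := by
    rw [e1] at e2
    have h3 := smul_right_injective _ (Nat.cast_ne_zero.2 (colCard_ne_zero lam) :
      (colCard lam : ℂ) ≠ 0) e2
    exact smul_left_injective ℂ hca h3
  have htr : spechtTrace lam (sumSquares n) = n.factorial := by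
    rw [spechtTrace_apply]
    have : Algebra.lsmul ℂ ℂ (spechtModule lam) (sumSquares n) = N • LinearMap.id := by
      refine LinearMap.ext fun v => Subtype.ext ?_
      obtain ⟨y, hy⟩ := exists_eq_mul_young lam v
      change sumSquares n * (v : GroupAlg n) = N • (v : GroupAlg n)
      rw [hy, mul_assoc y, ← mul_assoc, ← mul_sumSquares, mul_assoc]
      change y * (sumSquares n * c) = N • (y * c)
      rw [hkc, hkN, mul_smul_comm]
    rw [this, map_smul, LinearMap.trace_id, smul_eq_mul, hdim]
  rw [← htr, sumSquares, map_sum]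
  rfl

end Trace

/-! ### Formal exponentials and the weights `1 / z_π` -/

section Exponential

theorem zee_eq_prod {m : Multiset ℕ} {s : Finset ℕ} (hs : m.toFinset ⊆ s) :
    zee m = ∏ i ∈ s, (m.count i).factorial * i ^ m.count i := by
  refine Finset.prod_subset hs fun i _ hi => ?_
  rw [Multiset.mem_toFinset, ← Multiset.count_eq_zero] at hi
  simp [hi]

theorem zee_cons (a : ℕ) (m : Multiset ℕ) :
    zee (a ::ₘ m) = a * (m.count a + 1) * zee m := by
  have h1 : (a ::ₘ m).toFinset ⊆ insert a m.toFinset := by simp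
  have h2 : m.toFinset ⊆ insert a m.toFinset := Finset.subset_insert _ _
  rw [zee_eq_prod h1, zee_eq_prod h2, ← Finset.mul_prod_erase _ _ (Finset.mem_insert_self a _),
    ← Finset.mul_prod_erase _ (fun i => (m.count i).factorial * i ^ m.count i)
      (Finset.mem_insert_self a _),
    Finset.prod_congr (g := fun i => (m.count i).factorial * i ^ m.count i) rfl fun i hi => by
      rw [Multiset.count_cons_of_ne (Finset.ne_of_mem_erase hi)],
    Multiset.count_cons_self, Nat.factorial_succ, pow_succ]
  ring

theorem zee_ne_zero {m : Multiset ℕ} (hm : ∀ i ∈ m, 0 < i) : zee m ≠ 0 :=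
  Finset.prod_ne_zero_iff.2 fun i hi =>
    mul_ne_zero (Nat.factorial_ne_zero _) (pow_ne_zero _ (hm i (Multiset.mem_toFinset.1 hi)).ne')

variable {R : Type*} [CommRing R] [Algebra ℂ R]

/-- The sum of `z_π⁻¹ ∏ P_{π_i}` over the partitions `π` of `n`. -/
noncomputable def cycleExp (P : ℕ → R) (n : ℕ) : R :=
  ∑ π : Nat.Partition n, (zee π.parts : ℂ)⁻¹ • (π.parts.map P).prod

theorem cycleExp_zero (P : ℕ → R) : cycleExp P 0 = 1 := by
  rw [cycleExp, Fintype.sum_unique]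
  simp [zee]

/-- Newton's recursion: write `n = ∑ a · m_a(π)` and remove one part `a` from `π`; the factor `a ·
m_a(π)` is exactly the quotient of the two values of `zee`. -/
theorem nsmul_cycleExp (P : ℕ → R) (n : ℕ) :
    (n : ℂ) • cycleExp P n = ∑ a ∈ Finset.Icc 1 n, P a * cycleExp P (n - a) := by
  have hn : ∀ π : Nat.Partition n, (n : ℂ) = ∑ a ∈ Finset.Icc 1 n, ((a * π.parts.count a : ℕ) : ℂ) := by
    intro π
    rw [← Nat.cast_sum]
    congr 1
    conv_lhs => rw [← π.parts_sum, Finset.sum_multiset_count]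
    refine (Finset.sum_subset (fun a ha => ?_) fun a _ ha => ?_).trans
      (Finset.sum_congr rfl fun a _ => by rw [smul_eq_mul, mul_comm])
    · rw [Multiset.mem_toFinset] at ha
      exact Finset.mem_Icc.2 ⟨π.parts_pos ha, Nat.Partition.le_of_mem_parts ha⟩
    · rw [Multiset.mem_toFinset, ← Multiset.count_eq_zero] at ha
      simp [ha]
  have h1 : (n : ℂ) • cycleExp P n = ∑ a ∈ Finset.Icc 1 n, ∑ π : Nat.Partition n,
      (((a * π.parts.count a : ℕ) : ℂ) * (zee π.parts : ℂ)⁻¹) • (π.parts.map P).prod := by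
    rw [cycleExp, Finset.smul_sum, Finset.sum_comm]
    refine Finset.sum_congr rfl fun π _ => ?_
    rw [smul_smul, hn π, Finset.sum_mul, Finset.sum_smul]
  rw [h1]
  refine Finset.sum_congr rfl fun a ha => ?_
  obtain ⟨ha1, han⟩ := Finset.mem_Icc.1 ha
  rw [← Finset.sum_filter_of_ne (p := fun π : Nat.Partition n => a ∈ π.parts), cycleExp,
    Finset.mul_sum]
  · rw [Finset.sum_subtype _ (p := fun π : Nat.Partition n => a ∈ π.parts) (by simp)]
    refine Fintype.sum_equiv (Nat.Partition.partitionWithPartEquiv ha1 han) _ _ fun π => ?_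
    rw [Nat.Partition.partitionWithPartEquiv_apply_parts]
    obtain ⟨m, hm⟩ := Multiset.exists_cons_of_mem π.2
    have hpos : ∀ i ∈ m, 0 < i := fun i hi =>
      π.1.parts_pos (by rw [hm]; exact Multiset.mem_cons_of_mem hi)
    rw [hm, Multiset.erase_cons_head, zee_cons, Multiset.count_cons_self, Multiset.map_cons,
      Multiset.prod_cons, mul_smul_comm]
    congr 1
    have : (a : ℂ) ≠ 0 := by exact_mod_cast (by omega : a ≠ 0)
    have h2 : ((m.count a : ℂ) + 1) ≠ 0 := by exact_mod_cast Nat.succ_ne_zero (m.count a)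
    have h3 : (zee m : ℂ) ≠ 0 := by exact_mod_cast zee_ne_zero hpos
    push_cast
    field_simp
  · intro π _ hne
    by_contra hmem
    rw [← Multiset.count_eq_zero] at hmem
    exact hne (by simp [hmem])

/-- The generating function of `cycleExp`, formally `exp (∑ P_k t^k / k)`. -/
noncomputable def expSeries (P : ℕ → R) : PowerSeries R := PowerSeries.mk (cycleExp P)

theorem coeff_expSeries (P : ℕ → R) (n : ℕ) :
    PowerSeries.coeff n (expSeries P) = cycleExp P n := PowerSeries.coeff_mk _ _

theorem derivative_expSeries (P : ℕ → R) :
    PowerSeries.derivative R (expSeries P) =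
      PowerSeries.mk (fun k => P (k + 1)) * expSeries P := by
  ext n
  rw [PowerSeries.coeff_derivative, PowerSeries.coeff_mul, coeff_expSeries]
  have h := nsmul_cycleExp P (n + 1)
  rw [Algebra.smul_def, map_natCast] at h
  rw [mul_comm, ← Nat.cast_succ, Nat.succ_eq_add_one, h,
    Finset.Nat.sum_antidiagonal_eq_sum_range_succ_mk, Finset.range_eq_Ico,
    show Finset.Icc 1 (n + 1) = Finset.Ico (0 + 1) (n + 1 + 1) from rfl,
    ← Finset.sum_Ico_add' (fun a => P a * cycleExp P (n + 1 - a))]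
  refine Finset.sum_congr rfl fun k _ => ?_
  rw [PowerSeries.coeff_mk, coeff_expSeries, Nat.add_sub_add_right]

/-- The differential equation expresses `n + 1` times the coefficient of degree `n + 1` through
lower ones, and `n + 1` is a unit in a `ℂ`-algebra. All identities between exponentials below are
reduced to this uniqueness. -/
theorem eq_expSeries {P : ℕ → R} {f : PowerSeries R} (h0 : PowerSeries.coeff 0 f = 1)
    (h : PowerSeries.derivative R f = PowerSeries.mk (fun k => P (k + 1)) * f) :
    f = expSeries P := by
  ext n
  induction n using Nat.strong_induction_on with
  | _ n ih =>
    cases n with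
    | zero => rw [h0, coeff_expSeries, cycleExp_zero]
    | succ n =>
      have h1 := congrArg (PowerSeries.coeff n) h
      have h2 := congrArg (PowerSeries.coeff n) (derivative_expSeries P)
      rw [PowerSeries.coeff_derivative, PowerSeries.coeff_mul] at h1 h2
      have h3 : PowerSeries.coeff (n + 1) f * ((n : R) + 1) =
          PowerSeries.coeff (n + 1) (expSeries P) * ((n : R) + 1) := by
        rw [h1, h2]
        refine Finset.sum_congr rfl fun p hp => ?_
        rw [ih p.2 (by have := Finset.HasAntidiagonal.mem_antidiagonal.1 hp; omega)]
      have hu : IsUnit ((n : R) + 1) := by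
        have : IsUnit ((n : ℂ) + 1) := IsUnit.mk0 _ (by exact_mod_cast Nat.succ_ne_zero n)
        simpa using this.map (algebraMap ℂ R)
      exact hu.mul_left_injective h3

theorem expSeries_add (P Q : ℕ → R) : expSeries (P + Q) = expSeries P * expSeries Q := by
  symm
  apply eq_expSeries
  · simp [PowerSeries.coeff_mul, coeff_expSeries, cycleExp_zero]
  · rw [Derivation.leibniz, derivative_expSeries, derivative_expSeries]
    have : (PowerSeries.mk fun k => (P + Q) (k + 1)) =
        (PowerSeries.mk fun k => P (k + 1)) + PowerSeries.mk fun k => Q (k + 1) := by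
      ext k; simp
    rw [this, smul_eq_mul, smul_eq_mul]
    ring

theorem expSeries_zero : expSeries (0 : ℕ → R) = 1 := by
  symm
  apply eq_expSeries
  · simp
  · have : (PowerSeries.mk fun k => (0 : ℕ → R) (k + 1)) = 0 := by ext k; simp
    rw [this, zero_mul, Derivation.map_one_eq_zero]

theorem expSeries_sum {ι : Type*} (s : Finset ι) (P : ι → ℕ → R) :
    expSeries (∑ v ∈ s, P v) = ∏ v ∈ s, expSeries (P v) := by
  classical
  induction s using Finset.induction_on with
  | empty => rw [Finset.sum_empty, Finset.prod_empty, expSeries_zero]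
  | insert v s hv ih => rw [Finset.sum_insert hv, Finset.prod_insert hv, expSeries_add, ih]

theorem expSeries_pow (y : R) : expSeries (fun k => y ^ k) = PowerSeries.mk fun k => y ^ k := by
  symm
  apply eq_expSeries
  · simp
  · ext n
    rw [PowerSeries.coeff_derivative, PowerSeries.coeff_mul]
    simp only [PowerSeries.coeff_mk]
    rw [Finset.sum_congr rfl fun p hp => by
      rw [← pow_add, show p.1 + 1 + p.2 = n + 1 by
        have := Finset.HasAntidiagonal.mem_antidiagonal.1 hp
        omega]]
    simp [mul_comm]

/-- The exponent is `log (1 + y t)`, whose derivative is `y / (1 + y t)`. -/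
theorem expSeries_neg_pow (y : R) :
    expSeries (fun k => -(-y) ^ k) = 1 + PowerSeries.C y * PowerSeries.X := by
  symm
  apply eq_expSeries
  · simp
  · have h1 : (PowerSeries.mk fun k => -(-y) ^ (k + 1)) =
        PowerSeries.C y * PowerSeries.mk fun k => (-y) ^ k := by
      ext k
      rw [PowerSeries.coeff_C_mul, PowerSeries.coeff_mk, PowerSeries.coeff_mk]
      ring
    have h2 : (PowerSeries.mk fun k => (-y) ^ k) * (1 + PowerSeries.C y * PowerSeries.X) = 1 := by
      ext k
      rw [mul_add, mul_one, ← mul_assoc, mul_right_comm, mul_comm _ (PowerSeries.C y)]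
      cases k with
      | zero => simp
      | succ k =>
        rw [map_add, PowerSeries.coeff_C_mul, PowerSeries.coeff_succ_mul_X]
        simp [PowerSeries.coeff_one, pow_succ]
        ring
    rw [h1, mul_assoc, h2, mul_one, map_add, Derivation.map_one_eq_zero, zero_add]
    ext k
    rw [PowerSeries.coeff_derivative, PowerSeries.coeff_C_mul, PowerSeries.coeff_C,
      PowerSeries.coeff_X]
    by_cases hk : k = 0
    · simp [hk]
    · simp [hk]

end Exponential

/-! ### Sizes of conjugacy classes and the cycle index -/

section ClassSize

variable {α : Type*} [Fintype α] [DecidableEq α]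

theorem parts_eq_filter_add_replicate {n : ℕ} (π : Nat.Partition n) :
    π.parts = π.parts.filter (2 ≤ ·) +
      Multiset.replicate (n - (π.parts.filter (2 ≤ ·)).sum) 1 := by
  have hsplit := Multiset.filter_add_not (2 ≤ ·) π.parts
  have hone : π.parts.filter (fun i => ¬ 2 ≤ i) =
      Multiset.replicate (π.parts.filter (fun i => ¬ 2 ≤ i)).card 1 := by
    rw [Multiset.eq_replicate_card]
    intro i hi
    rw [Multiset.mem_filter] at hi
    have := π.parts_pos hi.1
    omega
  have hsum := congrArg Multiset.sum hsplit
  rw [Multiset.sum_add, π.parts_sum, hone, Multiset.sum_replicate, smul_eq_mul, mul_one] at hsum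
  rw [show n - (π.parts.filter (2 ≤ ·)).sum = (π.parts.filter (fun i => ¬ 2 ≤ i)).card by omega,
    ← hone, hsplit]

/-- Mathlib's `cycleType` omits fixed points, which contribute only a factorial to `zee`; this form
matches `Equiv.Perm.card_of_cycleType_mul_eq`. -/
theorem zee_partition {n : ℕ} (π : Nat.Partition n) :
    zee π.parts = (n - (π.parts.filter (2 ≤ ·)).sum).factorial * (π.parts.filter (2 ≤ ·)).prod *
      ∏ i ∈ (π.parts.filter (2 ≤ ·)).toFinset, ((π.parts.filter (2 ≤ ·)).count i).factorial := by
  conv_lhs => rw [parts_eq_filter_add_replicate π]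
  set m := π.parts.filter (2 ≤ ·) with hm
  have hrep : ∀ k, zee (m + Multiset.replicate k 1) = k.factorial * zee m := by
    intro k
    induction k with
    | zero => simp
    | succ k ih =>
      have h1 : m.count 1 = 0 := by
        rw [Multiset.count_eq_zero, hm, Multiset.mem_filter]
        omega
      rw [Multiset.replicate_succ, Multiset.add_cons, zee_cons, ih, Multiset.count_add, h1,
        Multiset.count_replicate_self, Nat.factorial_succ]
      ring
  rw [hrep, mul_assoc, zee, Finset.prod_mul_distrib,
    Finset.prod_multiset_count m, mul_comm (∏ i ∈ m.toFinset, (m.count i).factorial)]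

theorem partition_eq_iff (g : Equiv.Perm α) (π : Nat.Partition (Fintype.card α)) :
    g.partition = π ↔ g.cycleType = π.parts.filter (2 ≤ ·) := by
  constructor
  · rintro rfl
    exact Equiv.Perm.filter_parts_partition_eq_cycleType.symm
  · intro h
    apply Nat.Partition.ext
    rw [Equiv.Perm.parts_partition, ← Equiv.Perm.sum_cycleType, h,
      ← parts_eq_filter_add_replicate]

theorem card_partition_mul_zee (π : Nat.Partition (Fintype.card α)) :
    #{g : Equiv.Perm α | g.partition = π} * zee π.parts = (Fintype.card α).factorial := by
  have h := Equiv.Perm.card_of_cycleType_mul_eq α (π.parts.filter (2 ≤ ·))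
  have hle : (π.parts.filter (2 ≤ ·)).sum ≤ Fintype.card α := by
    have h1 := congrArg Multiset.sum (Multiset.filter_add_not (2 ≤ ·) π.parts)
    rw [Multiset.sum_add, π.parts_sum] at h1
    omega
  rw [if_pos ⟨hle, fun a ha => (Multiset.mem_filter.1 ha).2⟩, ← zee_partition] at h
  rw [← h]
  congr 2
  ext g
  simp [partition_eq_iff]

/-- The cycle index: averaging over all permutations is the sum over partitions with weights
`1 / z_π`. -/
theorem sum_perm_prod_parts {R : Type*} [CommRing R] [Algebra ℂ R] (P : ℕ → R) :
    ∑ g : Equiv.Perm α, (g.partition.parts.map P).prod =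
      ((Fintype.card α).factorial : ℂ) • cycleExp P (Fintype.card α) := by
  rw [cycleExp, Finset.smul_sum, ← Finset.sum_fiberwise univ
    (fun g : Equiv.Perm α => g.partition)]
  refine Finset.sum_congr rfl fun π _ => ?_
  rw [Finset.sum_congr rfl fun g hg => by rw [(Finset.mem_filter.1 hg).2], Finset.sum_const,
    ← Nat.cast_smul_eq_nsmul ℂ, smul_smul, ← card_partition_mul_zee π]
  congr 1
  have : (zee π.parts : ℂ) ≠ 0 := by exact_mod_cast zee_ne_zero fun i hi => π.parts_pos hi
  push_cast
  field_simp

end ClassSize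

/-! ### Cycle types of squares and sums over Young subgroups -/

section CycleTypes

variable {α : Type*} [Fintype α] [DecidableEq α]

theorem subtypeCongr_eq_mul {β : Type*} {p : β → Prop} [DecidablePred p] (e : Equiv.Perm {a // p a})
    (f : Equiv.Perm {a // ¬ p a}) :
    e.subtypeCongr f = Equiv.Perm.ofSubtype e * Equiv.Perm.ofSubtype f := by
  ext x
  rw [Equiv.Perm.mul_apply]
  by_cases hx : p x
  · rw [Equiv.Perm.subtypeCongr.left_apply _ _ hx, Equiv.Perm.ofSubtype_apply_of_not_mem f
      (not_not.2 hx), Equiv.Perm.ofSubtype_apply_of_mem e hx]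
  · rw [Equiv.Perm.subtypeCongr.right_apply _ _ hx, Equiv.Perm.ofSubtype_apply_of_mem f hx,
      Equiv.Perm.ofSubtype_apply_of_not_mem e (f ⟨x, hx⟩).2]

theorem parts_subtypeCongr {p : α → Prop} [DecidablePred p] (e : Equiv.Perm {a // p a})
    (f : Equiv.Perm {a // ¬ p a}) :
    (e.subtypeCongr f).partition.parts = e.partition.parts + f.partition.parts := by
  have hd : (Equiv.Perm.ofSubtype e).Disjoint (Equiv.Perm.ofSubtype f) := by
    intro x
    by_cases hx : p x
    · exact Or.inr (Equiv.Perm.ofSubtype_apply_of_not_mem f (not_not.2 hx))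
    · exact Or.inl (Equiv.Perm.ofSubtype_apply_of_not_mem e hx)
  have hc : (e.subtypeCongr f).cycleType = e.cycleType + f.cycleType := by
    rw [subtypeCongr_eq_mul, hd.cycleType_mul, Equiv.Perm.cycleType_ofSubtype,
      Equiv.Perm.cycleType_ofSubtype]
  have hcard : Fintype.card {a // p a} + Fintype.card {a // ¬ p a} = Fintype.card α :=
    Fintype.card_congr (Equiv.sumCompl p) ▸ (Fintype.card_sum).symm
  have h1 := e.sum_cycleType_le
  have h2 := f.sum_cycleType_le
  rw [Equiv.Perm.parts_partition, Equiv.Perm.parts_partition, Equiv.Perm.parts_partition,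
    ← Equiv.Perm.sum_cycleType, ← Equiv.Perm.sum_cycleType, ← Equiv.Perm.sum_cycleType, hc,
    Multiset.sum_add, show Fintype.card α - (e.cycleType.sum + f.cycleType.sum) =
      (Fintype.card {a // p a} - e.cycleType.sum) + (Fintype.card {a // ¬ p a} - f.cycleType.sum)
      by omega, Multiset.replicate_add]
  abel

theorem subtypePerm_subtypeCongr {β : Type*} {p : β → Prop} [DecidablePred p] (h : Equiv.Perm β)
    (h1 : ∀ x, p (h x) ↔ p x) (h2 : ∀ x, ¬ p (h x) ↔ ¬ p x) :
    (h.subtypePerm h1).subtypeCongr (h.subtypePerm h2) = h := by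
  ext x
  by_cases hx : p x
  · rw [Equiv.Perm.subtypeCongr.left_apply _ _ hx]; rfl
  · rw [Equiv.Perm.subtypeCongr.right_apply _ _ hx]; rfl

/-- If all points have period `m` then all cycles have length `m`. -/
theorem parts_eq_replicate (g : Equiv.Perm α) {m : ℕ}
    (hg : ∀ (y : α) (j : ℕ), (g ^ j) y = y ↔ m ∣ j) :
    ∃ r, g.partition.parts = Multiset.replicate r m ∧ r * m = Fintype.card α := by
  have hall : ∀ i ∈ g.partition.parts, i = m := by
    intro i hi
    rw [Equiv.Perm.parts_partition, Multiset.mem_add] at hi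
    rcases hi with hi | hi
    · rw [Equiv.Perm.cycleType_def, Multiset.mem_map] at hi
      obtain ⟨c, hc, rfl⟩ := hi
      obtain ⟨hcyc, hcg⟩ := Equiv.Perm.mem_cycleFactorsFinset_iff.1 hc
      obtain ⟨y, hy⟩ : c.support.Nonempty := by
        rw [Finset.nonempty_iff_ne_empty, Ne, Equiv.Perm.support_eq_empty_iff]
        exact hcyc.ne_one
      have hcy : c = g.cycleOf y := Equiv.Perm.cycle_is_cycleOf hy hc
      have key : ∀ j, #c.support ∣ j ↔ m ∣ j := by
        intro j
        rw [← hcyc.orderOf, orderOf_dvd_iff_pow_eq_one,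
          hcyc.pow_eq_one_iff' (Equiv.Perm.mem_support.1 hy), ← hg y, hcy,
          Equiv.Perm.cycleOf_pow_apply_self]
      exact Nat.dvd_antisymm ((key m).2 dvd_rfl) ((key _).1 dvd_rfl)
    · obtain ⟨hne, rfl⟩ := Multiset.mem_replicate.1 hi
      have : ∃ y, y ∉ g.support := by
        by_contra! hcon
        rw [Finset.eq_univ_of_forall hcon, Finset.card_univ, Nat.sub_self] at hne
        exact hne rfl
      obtain ⟨y, hy⟩ := this
      rw [Equiv.Perm.notMem_support] at hy
      exact (Nat.dvd_one.1 ((hg y 1).1 (by rwa [pow_one]))).symm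
  refine ⟨g.partition.parts.card, Multiset.eq_replicate.2 ⟨rfl, hall⟩, ?_⟩
  have := g.partition.parts_sum
  rw [Multiset.eq_replicate.2 ⟨rfl, hall⟩, Multiset.sum_replicate, smul_eq_mul] at this
  exact this

variable {R : Type*} [CommRing R]

/-- The cycle lengths of a square: a cycle of odd length stays a cycle, a cycle of even length
splits into two. -/
def squareWeight (p : ℕ → R) (k : ℕ) : R := if Even k then p (k / 2) ^ 2 else p k

/-- For a single cycle of length `k`, the power `(h²)^j` fixes a point iff `k ∣ 2 j`; so all points
have period `k / 2` under `h²` for even `k`, and `k` for odd `k`. -/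
theorem prod_parts_sq_of_isCycleOn [Nonempty α] (p : ℕ → R) (h : Equiv.Perm α)
    (hh : h.IsCycleOn (univ : Finset α)) :
    ((h * h).partition.parts.map p).prod = (h.partition.parts.map (squareWeight p)).prod := by
  have hk : Fintype.card α ≠ 0 := Fintype.card_ne_zero
  have hper : ∀ (y : α) (j : ℕ), (h ^ j) y = y ↔ Fintype.card α ∣ j := fun y j =>
    hh.pow_apply_eq (Finset.mem_univ y)
  have hper2 : ∀ (y : α) (j : ℕ), ((h * h) ^ j) y = y ↔ Fintype.card α ∣ 2 * j := fun y j => by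
    rw [← hper y, pow_mul, pow_two]
  obtain ⟨r, hr, hrm⟩ := parts_eq_replicate h hper
  have hr1 : r = 1 := by
    have : r * Fintype.card α = 1 * Fintype.card α := by rw [hrm, one_mul]
    exact Nat.eq_of_mul_eq_mul_right (Nat.pos_of_ne_zero hk) this
  rw [hr, hr1, Multiset.map_replicate, Multiset.prod_replicate, pow_one, squareWeight]
  by_cases he : Even (Fintype.card α)
  · obtain ⟨m, hm⟩ := he
    rw [if_pos ⟨m, hm⟩]
    have hm2 : Fintype.card α / 2 = m := by omega
    obtain ⟨s, hs, hsm⟩ := parts_eq_replicate (h * h) (m := m) fun y j => by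
      rw [hper2, hm, ← two_mul]
      exact Nat.mul_dvd_mul_iff_left two_pos
    have hs2 : s = 2 := by
      have : s * m = 2 * m := by omega
      exact Nat.eq_of_mul_eq_mul_right (by omega) this
    rw [hs, hs2, Multiset.map_replicate, Multiset.prod_replicate, hm2]
  · rw [if_neg he]
    obtain ⟨s, hs, hsm⟩ := parts_eq_replicate (h * h) (m := Fintype.card α) fun y j => by
      rw [hper2]
      exact (Nat.Coprime.dvd_mul_left
        (Nat.coprime_two_right.2 (Nat.not_even_iff_odd.1 he)))
    have hs1 : s = 1 := by
      have : s * Fintype.card α = 1 * Fintype.card α := by rw [hsm, one_mul]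
      exact Nat.eq_of_mul_eq_mul_right (Nat.pos_of_ne_zero hk) this
    rw [hs, hs1, Multiset.map_replicate, Multiset.prod_replicate, pow_one]

theorem prod_parts_sq (p : ℕ → R) (k : ℕ) : ∀ (α : Type) [Fintype α] [DecidableEq α]
    (h : Equiv.Perm α), Fintype.card α = k →
    ((h * h).partition.parts.map p).prod = (h.partition.parts.map (squareWeight p)).prod := by
  induction k using Nat.strong_induction_on with
  | _ k ih =>
    intro α _ _ h hk
    cases isEmpty_or_nonempty α with
    | inl he =>
      rw [Equiv.Perm.parts_partition, Equiv.Perm.parts_partition, Subsingleton.elim (h * h) 1,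
        Subsingleton.elim h 1]
      simp
    | inr hne =>
      obtain ⟨x⟩ := hne
      classical
      -- Split off the cycle through `x`; both `h` and its square respect the decomposition, and the
      -- complement is smaller.
      let P : α → Prop := fun y => h.SameCycle x y
      have h1 : ∀ y, P (h y) ↔ P y := fun y => Equiv.Perm.sameCycle_apply_right
      have h2 : ∀ y, ¬ P (h y) ↔ ¬ P y := fun y => not_congr (h1 y)
      have hx : P x := Equiv.Perm.SameCycle.refl _ _
      have : Nonempty {y // P y} := ⟨⟨x, hx⟩⟩
      have hcyc : (h.subtypePerm h1).IsCycleOn (univ : Finset {y // P y}) := by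
        refine ⟨by simp, ?_⟩
        intro y _ z _
        rw [Equiv.Perm.sameCycle_subtypePerm]
        exact y.2.symm.trans z.2
      have hlt : Fintype.card {y // ¬ P y} < k := by
        rw [← hk]
        exact Fintype.card_subtype_lt (x := x) (not_not.2 hx)
      have hh1 : ∀ y, P ((h * h) y) ↔ P y := fun y => (h1 _).trans (h1 _)
      have hh2 : ∀ y, ¬ P ((h * h) y) ↔ ¬ P y := fun y => (h2 _).trans (h2 _)
      conv_lhs => rw [← subtypePerm_subtypeCongr (h * h) hh1 hh2]
      conv_rhs => rw [← subtypePerm_subtypeCongr h h1 h2]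
      rw [parts_subtypeCongr, parts_subtypeCongr, Multiset.map_add, Multiset.map_add,
        Multiset.prod_add, Multiset.prod_add, ← prod_parts_sq_of_isCycleOn p _ hcyc,
        ← ih _ hlt _ (h.subtypePerm h2) rfl]
      rfl

/-- Averages over a Young subgroup factor. -/
theorem sum_stabilizer_prod_parts [Algebra ℂ R] (P : ℕ → R) (N : ℕ) :
    ∀ (α : Type) [Fintype α] [DecidableEq α] (f : α → ℕ), (∀ i, f i < N) →
    ∑ g : Equiv.Perm α with ∀ i, f (g i) = f i, (g.partition.parts.map P).prod =
      ∏ j ∈ range N, ((#{i | f i = j}).factorial : ℂ) • cycleExp P #{i | f i = j} := by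
  induction N with
  | zero =>
    intro α _ _ f hf
    have : IsEmpty α := ⟨fun i => absurd (hf i) (Nat.not_lt_zero _)⟩
    rw [Finset.prod_range_zero, Finset.filter_true_of_mem (fun g _ i => isEmptyElim i),
      Fintype.sum_unique, Equiv.Perm.parts_partition]
    simp
  | succ N ih =>
    intro α _ _ f hf
    -- A permutation preserving `f` is an arbitrary permutation of the top fibre together with one
    -- preserving `f` on the complement.
    let p : α → Prop := fun i => f i = N
    have hrest := ih {i // ¬ p i} (fun i => f i) fun i => lt_of_le_of_ne
      (Nat.lt_succ_iff.1 (hf i)) i.2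
    have hcard : ∀ j ∈ range N, #{i : {i // ¬ p i} | f i = j} = #{i | f i = j} := by
      intro j hj
      refine Finset.card_bij (fun i _ => i.1) (fun i hi => by simpa using hi)
        (fun i _ k _ h => Subtype.ext h) fun i hi => ?_
      have hi' : f i = j := by simpa using hi
      have hj' := Finset.mem_range.1 hj
      exact ⟨⟨i, fun h : f i = N => by omega⟩, by simpa using hi', rfl⟩
    rw [Finset.prod_congr rfl fun j hj => by rw [hcard j hj]] at hrest
    have hp : Fintype.card {i // p i} = #{i | f i = N} := Fintype.card_subtype p
    rw [Finset.prod_range_succ, ← hrest, ← hp, ← sum_perm_prod_parts, mul_comm,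
      Finset.sum_mul_sum, ← Finset.sum_product']
    symm
    refine Finset.sum_bij (fun x _ => x.1.subtypeCongr x.2) ?_ ?_ ?_ ?_
    · rintro ⟨e, g⟩ hx
      simp only [Finset.mem_product, Finset.mem_univ, Finset.mem_filter, true_and] at hx ⊢
      intro i
      by_cases hi : p i
      · rw [Equiv.Perm.subtypeCongr.left_apply _ _ hi]
        exact (e ⟨i, hi⟩).2.trans hi.symm
      · rw [Equiv.Perm.subtypeCongr.right_apply _ _ hi]
        exact hx ⟨i, hi⟩
    · rintro ⟨e, g⟩ _ ⟨e', g'⟩ _ h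
      exact Equiv.Perm.subtypeCongrHom_injective p h
    · intro g hg
      simp only [Finset.mem_filter, Finset.mem_univ, true_and] at hg
      have h1 : ∀ i, p (g i) ↔ p i := fun i => by simp only [p, hg i]
      have h2 : ∀ i, ¬ p (g i) ↔ ¬ p i := fun i => not_congr (h1 i)
      refine ⟨(g.subtypePerm h1, g.subtypePerm h2), ?_, subtypePerm_subtypeCongr g h1 h2⟩
      simp only [Finset.mem_product, Finset.mem_univ, Finset.mem_filter, true_and]
      exact fun i => hg i
    · rintro ⟨e, g⟩ _
      rw [parts_subtypeCongr, Multiset.map_add, Multiset.prod_add]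

/-- Set all `P k = 1` in `sum_stabilizer_prod_parts`: the exponential becomes the geometric series,
so every `cycleExp` is `1`. -/
theorem card_stabilizer_fibers {α : Type} [Fintype α] [DecidableEq α] (f : α → ℕ) {N : ℕ}
    (hf : ∀ i, f i < N) :
    #{g : Equiv.Perm α | ∀ i, f (g i) = f i} = ∏ j ∈ range N, (#{i | f i = j}).factorial := by
  have h := sum_stabilizer_prod_parts (R := ℂ) (fun k => (1 : ℂ) ^ k) N α f hf
  have h1 : ∀ k, cycleExp (fun k => (1 : ℂ) ^ k) k = 1 := fun k => by
    rw [← coeff_expSeries, expSeries_pow, PowerSeries.coeff_mk, one_pow]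
  simp only [h1, smul_eq_mul, mul_one] at h
  simp only [one_pow, mul_one, Multiset.map_const', Multiset.prod_replicate,
    Finset.sum_const, nsmul_eq_mul] at h
  exact_mod_cast h

end CycleTypes

/-! ### Alternating polynomials and Pieri rules -/

open MvPolynomial

section Alternating

variable {N : ℕ}

/-- The coefficient of the monomial with exponents `v`. -/
noncomputable def cf (G : MvPolynomial (Fin N) ℂ) (v : Fin N → ℕ) : ℂ :=
  coeff (Finsupp.equivFunOnFinite.symm v) G

/-- The exponents `l + δ`, where `δ = (N - 1, …, 1, 0)`. -/
def shift (l : Fin N → ℕ) (i : Fin N) : ℕ := l i + (N - 1 - i)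

/-- A polynomial changing sign under transpositions of the variables. -/
def IsAlternating (G : MvPolynomial (Fin N) ℂ) : Prop :=
  ∀ i j : Fin N, i ≠ j → rename (Equiv.swap i j) G = -G

theorem cf_comp_swap {G : MvPolynomial (Fin N) ℂ} (hG : IsAlternating G) {i j : Fin N}
    (hij : i ≠ j) (v : Fin N → ℕ) : cf G (v ∘ Equiv.swap i j) = -cf G v := by
  have h1 := coeff_rename_mapDomain (Equiv.swap i j) (Equiv.swap i j).injective G
    (Finsupp.equivFunOnFinite.symm v)
  rw [hG i j hij, coeff_neg] at h1
  rw [cf, cf, ← h1, neg_neg]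
  congr 1
  ext k
  rw [Finsupp.mapDomain_equiv_apply]
  simp

theorem cf_eq_zero {G : MvPolynomial (Fin N) ℂ} (hG : IsAlternating G) {v : Fin N → ℕ}
    (hv : ¬ Function.Injective v) : cf G v = 0 := by
  simp only [Function.Injective, not_forall] at hv
  obtain ⟨i, j, hij, hne⟩ := hv
  have h := cf_comp_swap hG hne v
  have hv : v ∘ Equiv.swap i j = v := by
    ext k
    by_cases h1 : k = i
    · simp [h1, hij]
    · by_cases h2 : k = j
      · simp [h2, hij]
      · simp [Equiv.swap_apply_of_ne_of_ne h1 h2]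
  rw [hv] at h
  exact self_eq_neg.1 h

theorem IsAlternating.mul {G F : MvPolynomial (Fin N) ℂ} (hG : IsAlternating G)
    (hF : F.IsSymmetric) : IsAlternating (G * F) := fun i j hij => by
  rw [map_mul, hG i j hij, hF, neg_mul]

/-- The alternant `∑ sgn(w) x^{w δ}`. -/
noncomputable def alternant (N : ℕ) : MvPolynomial (Fin N) ℂ :=
  ∑ w : Equiv.Perm (Fin N), ((Equiv.Perm.sign w : ℤ) : ℂ) •
    monomial (Finsupp.equivFunOnFinite.symm fun i => N - 1 - (w i : ℕ)) 1

theorem isAlternating_alternant : IsAlternating (alternant N) := by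
  intro i j hij
  rw [alternant, map_sum, ← Finset.sum_neg_distrib]
  refine Finset.sum_equiv (Equiv.mulRight (Equiv.swap i j)) (by simp) fun w _ => ?_
  rw [map_smul, rename_monomial, Equiv.coe_mulRight, Equiv.Perm.sign_mul, Equiv.Perm.sign_swap hij,
    mul_neg, mul_one, Units.val_neg, Int.cast_neg, neg_smul, neg_neg]
  congr 3
  ext k
  rw [Finsupp.mapDomain_equiv_apply]
  simp

/-- Comparing the sums of the exponents of `w δ` and `l + δ` forces `l = 0`, and then `w = 1`
because the entries of `δ` are distinct. -/
theorem cf_alternant (l : Fin N → ℕ) : cf (alternant N) (shift l) = if l = 0 then 1 else 0 := by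
  have key : ∀ w : Equiv.Perm (Fin N), (fun i => N - 1 - (w i : ℕ)) = shift l → l = 0 ∧ w = 1 := by
    intro w hw
    have hsum := congrArg (fun v : Fin N → ℕ => ∑ i, v i) hw
    simp only [shift, Finset.sum_add_distrib] at hsum
    rw [Equiv.sum_comp w fun i : Fin N => N - 1 - (i : ℕ)] at hsum
    have hl : ∑ i, l i = 0 := by omega
    have hl0 : l = 0 := by
      ext i
      exact Finset.sum_eq_zero_iff.1 hl i (Finset.mem_univ i)
    refine ⟨hl0, ?_⟩
    ext i
    have := congrFun hw i
    simp only [shift, hl0, Pi.zero_apply] at this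
    have h1 := (w i).2
    have h2 := i.2
    simp only [Equiv.Perm.coe_one, id_eq]
    omega
  rw [cf, alternant, coeff_sum]
  simp only [coeff_smul, coeff_monomial, smul_eq_mul, mul_ite, mul_one, mul_zero,
    Equiv.apply_eq_iff_eq]
  split_ifs with hl
  · rw [Finset.sum_eq_single 1, if_pos]
    · simp
    · ext i
      simp [shift, hl]
    · intro w _ hw
      exact if_neg fun h => hw (key w h).2
    · simp
  · exact Finset.sum_eq_zero fun w _ => if_neg fun h => hl (key w h).1

theorem add_sub_le_of_strictAnti {v : Fin N → ℕ} (hv : StrictAnti v) :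
    ∀ (k : ℕ) (i j : Fin N), (j : ℕ) = i + k → v j + k ≤ v i := by
  intro k
  induction k with
  | zero =>
    intro i j h
    rw [Fin.ext (by omega : (j : ℕ) = i)]
    exact le_rfl
  | succ k ih =>
    intro i j h
    have hk : (i : ℕ) + k < N := by have := j.2; omega
    have h1 := ih i ⟨i + k, hk⟩ rfl
    have h2 : v j < v ⟨i + k, hk⟩ := hv (by rw [Fin.lt_def]; simp only; omega)
    omega

/-- Strict decrease gives `v i ≥ N - 1 - i`, so `δ` can be subtracted without truncation. -/
theorem exists_shift_eq {v : Fin N → ℕ} (hv : StrictAnti v) :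
    ∃ l : Fin N → ℕ, Antitone l ∧ shift l = v := by
  have hlow : ∀ i : Fin N, N - 1 - (i : ℕ) ≤ v i := by
    intro i
    have := add_sub_le_of_strictAnti hv (N - 1 - i) i ⟨N - 1, by have := i.2; omega⟩
      (by have := i.2; simp only; omega)
    omega
  refine ⟨fun i => v i - (N - 1 - i), fun i j hij => ?_, ?_⟩
  · have h1 := add_sub_le_of_strictAnti hv (j - i) i j (by rw [Fin.le_def] at hij; omega)
    have h2 := hlow i
    have h3 := hlow j
    rw [Fin.le_def] at hij
    have h4 := j.2
    simp only
    omega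
  · ext i
    have := hlow i
    simp only [shift]
    omega

/-! ### Multiplication by elementary symmetric polynomials -/

theorem cf_mul_prod_X (G : MvPolynomial (Fin N) ℂ) (S : Finset (Fin N)) (v : Fin N → ℕ) :
    cf (G * ∏ i ∈ S, X i) v =
      if ∀ i ∈ S, 1 ≤ v i then cf G (fun i => v i - if i ∈ S then 1 else 0) else 0 := by
  have : (∏ i ∈ S, X i : MvPolynomial (Fin N) ℂ) =
      monomial (Finsupp.equivFunOnFinite.symm fun i => if i ∈ S then 1 else 0) 1 := by
    rw [monomial_eq, map_one, one_mul, Finsupp.prod_fintype _ _ (by simp)]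
    simp [Finset.prod_ite_mem]
  rw [this, cf, coeff_mul_monomial', mul_one]
  have hle : (Finsupp.equivFunOnFinite.symm fun i => if i ∈ S then 1 else 0) ≤
      Finsupp.equivFunOnFinite.symm v ↔ ∀ i ∈ S, 1 ≤ v i := by
    rw [Finsupp.le_def]
    refine forall_congr' fun i => ?_
    by_cases hi : i ∈ S <;> simp [hi]
  refine if_congr hle ?_ rfl
  rw [cf]
  congr 1
  ext i
  simp

/-- Removing a vertical strip `S`: a nonzero coefficient forces `l - 1_S` to be a partition. -/
theorem exists_vertical_strip {l : Fin N → ℕ} (hl : Antitone l) {S : Finset (Fin N)}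
    (hinj : Function.Injective fun i => shift l i - if i ∈ S then 1 else 0)
    (hS : ∀ i ∈ S, 1 ≤ shift l i) :
    ∃ μ : Fin N → ℕ, Antitone μ ∧ (∀ i, l i = μ i + if i ∈ S then 1 else 0) ∧
      shift μ = fun i => shift l i - if i ∈ S then 1 else 0 := by
  -- Lowering some entries of a strictly decreasing sequence by one leaves it weakly decreasing;
  -- injectivity makes it strict.
  have hanti : StrictAnti fun i => shift l i - if i ∈ S then 1 else 0 := by
    intro i j hij
    have hne : (shift l i - if i ∈ S then 1 else 0) ≠ shift l j - if j ∈ S then 1 else 0 :=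
      fun h => hij.ne (hinj h)
    have h1 := hl hij.le
    have h2 := j.2
    rw [Fin.lt_def] at hij
    have h3 : (if i ∈ S then 1 else 0) ≤ 1 := by split_ifs <;> simp
    simp only [shift] at hne ⊢
    omega
  obtain ⟨μ, hμ, hμs⟩ := exists_shift_eq hanti
  refine ⟨μ, hμ, fun i => ?_, hμs⟩
  have h1 := congrFun hμs i
  simp only [shift] at h1
  by_cases hi : i ∈ S
  · have h2 := hS i hi
    simp only [shift, hi, if_true] at h1 h2 ⊢
    omega
  · simp only [hi, if_false] at h1 ⊢
    omega

/-! ### Multiplication by complete homogeneous symmetric polynomials -/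

/-- The complete homogeneous symmetric polynomial. -/
noncomputable def hPoly (N r : ℕ) : MvPolynomial (Fin N) ℂ :=
  ∑ d ∈ finsuppAntidiag (univ : Finset (Fin N)) r, monomial d 1

theorem cf_mul_hPoly (G : MvPolynomial (Fin N) ℂ) (r : ℕ) (v : Fin N → ℕ) :
    cf (G * hPoly N r) v =
      ∑ β ∈ Fintype.piFinset (fun i => range (v i + 1)) with ∑ i, β i + r = ∑ i, v i, cf G β := by
  rw [cf, hPoly, Finset.mul_sum, coeff_sum]
  simp only [coeff_mul_monomial', mul_one]
  rw [← Finset.sum_filter]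
  refine Finset.sum_bij' (fun d _ => fun i => v i - d i)
    (fun β _ => Finsupp.equivFunOnFinite.symm fun i => v i - β i) ?_ ?_ ?_ ?_ ?_
  · intro d hd
    simp only [Finset.mem_filter, mem_finsuppAntidiag, Finsupp.le_def] at hd
    obtain ⟨⟨hd1, -⟩, hd2⟩ := hd
    simp only [Finset.mem_filter, Fintype.mem_piFinset, Finset.mem_range]
    refine ⟨fun i => by omega, ?_⟩
    rw [← hd1, ← Finset.sum_add_distrib]
    refine Finset.sum_congr rfl fun i _ => ?_
    have := hd2 i
    simp only [Finsupp.equivFunOnFinite_symm_apply_apply] at this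
    omega
  · intro β hβ
    simp only [Finset.mem_filter, Fintype.mem_piFinset, Finset.mem_range] at hβ
    simp only [Finset.mem_filter, mem_finsuppAntidiag, Finsupp.le_def]
    refine ⟨⟨?_, by simp⟩, fun i => by simp⟩
    have h1 : ∑ i, (v i - β i) + ∑ i, β i = ∑ i, v i := by
      rw [← Finset.sum_add_distrib]
      exact Finset.sum_congr rfl fun i _ => Nat.sub_add_cancel (Nat.lt_succ_iff.1 (hβ.1 i))
    simp only [Finsupp.equivFunOnFinite_symm_apply_apply]
    omega
  · intro d hd
    simp only [Finset.mem_filter, mem_finsuppAntidiag, Finsupp.le_def] at hd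
    ext i
    have := hd.2 i
    simp only [Finsupp.equivFunOnFinite_symm_apply_apply] at this ⊢
    omega
  · intro β hβ
    simp only [Finset.mem_filter, Fintype.mem_piFinset, Finset.mem_range] at hβ
    ext i
    have := hβ.1 i
    simp only [Finsupp.equivFunOnFinite_symm_apply_apply]
    omega
  · intro d _
    rw [cf]
    congr 1
    ext i
    simp

/-- The partitions `μ` such that `l / μ` is a horizontal strip of size `r`. -/
def hStrips (l : Fin N → ℕ) (r : ℕ) : Finset (Fin N → ℕ) :=
  {μ ∈ Fintype.piFinset (fun i => range (l i + 1)) |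
    (∀ i j, i < j → l j ≤ μ i) ∧ ∑ i, μ i + r = ∑ i, l i}

theorem mem_hStrips {l μ : Fin N → ℕ} {r : ℕ} : μ ∈ hStrips l r ↔
    (∀ i, μ i ≤ l i) ∧ (∀ i j, i < j → l j ≤ μ i) ∧ ∑ i, μ i + r = ∑ i, l i := by
  simp [hStrips]

theorem antitone_of_mem_hStrips {l μ : Fin N → ℕ} {r : ℕ} (h : μ ∈ hStrips l r) : Antitone μ := by
  obtain ⟨h1, h2, -⟩ := mem_hStrips.1 h
  intro i j hij
  rcases hij.eq_or_lt with rfl | hlt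
  · exact le_rfl
  · exact (h1 j).trans (h2 i j hlt)

theorem sum_shift_add (l : Fin N → ℕ) : ∑ i, shift l i = ∑ i, l i + ∑ i : Fin N, (N - 1 - (i : ℕ)) :=
  Finset.sum_add_distrib

open Classical in
/-- Exponents violating the interlacing condition cancel in pairs. -/
theorem sum_not_interlacing_eq_zero {G : MvPolynomial (Fin N) ℂ} (hG : IsAlternating G)
    {v : Fin N → ℕ} (hv : Antitone v) (r : ℕ) :
    ∑ β ∈ Fintype.piFinset (fun i => range (v i + 1)) with (∑ i, β i + r = ∑ i, v i) ∧
      ∃ (k : ℕ) (h : k + 1 < N), β ⟨k, by omega⟩ ≤ v ⟨k + 1, h⟩, cf G β = 0 := by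
  classical
  let Bad : (Fin N → ℕ) → ℕ → Prop := fun β k => ∃ h : k + 1 < N, β ⟨k, by omega⟩ ≤ v ⟨k + 1, h⟩
  have hmem : ∀ β : Fin N → ℕ, (β ∈ Finset.filter (fun β => (∑ i, β i + r = ∑ i, v i) ∧
      ∃ (k : ℕ) (h : k + 1 < N), β ⟨k, by omega⟩ ≤ v ⟨k + 1, h⟩)
      (Fintype.piFinset (fun i => range (v i + 1)))) ↔
      (∀ i, β i ≤ v i) ∧ (∑ i, β i + r = ∑ i, v i) ∧ ∃ k, Bad β k := by
    intro β
    simp [Bad]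
  let sw : (Fin N → ℕ) → ℕ → (Fin N → ℕ) := fun β k =>
    if h : k + 1 < N then β ∘ Equiv.swap ⟨k, by omega⟩ ⟨k + 1, h⟩ else β
  -- The cancelling involution swaps the entries `k` and `k + 1` at the first violation `k`. Both
  -- are at most `v (k + 1)`, so the bounds survive and `k` stays a violation; earlier positions are
  -- untouched, so it stays the first.
  have hfind : ∀ (β : Fin N → ℕ) (hb : ∃ k, Bad β k), (∀ i, β i ≤ v i) →
      (∀ i, sw β (Nat.find hb) i ≤ v i) ∧ ∃ hb' : ∃ k, Bad (sw β (Nat.find hb)) k,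
        Nat.find hb' = Nat.find hb := by
    intro β hb hle
    obtain ⟨hk, hbad⟩ := Nat.find_spec hb
    have hmin := fun m (hm : m < Nat.find hb) => Nat.find_min hb hm
    set k := Nat.find hb with hkdef
    have hsw : sw β k = β ∘ Equiv.swap ⟨k, by omega⟩ ⟨k + 1, hk⟩ := dif_pos hk
    have hbk : Bad (sw β k) k := ⟨hk, by rw [hsw]; simpa using hle ⟨k + 1, hk⟩⟩
    refine ⟨fun i => ?_, ⟨k, hbk⟩, (Nat.find_eq_iff _).2 ⟨hbk, fun m hm hbm => hmin m hm ?_⟩⟩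
    · rw [hsw, Function.comp_apply]
      by_cases h1 : i = ⟨k, by omega⟩
      · rw [h1, Equiv.swap_apply_left]
        exact (hle _).trans (hv (by rw [Fin.le_def]; simp))
      · by_cases h2 : i = ⟨k + 1, hk⟩
        · rw [h2, Equiv.swap_apply_right]
          exact hbad
        · rw [Equiv.swap_apply_of_ne_of_ne h1 h2]
          exact hle i
    · obtain ⟨h, hb2⟩ := hbm
      refine ⟨h, ?_⟩
      rwa [hsw, Function.comp_apply, Equiv.swap_apply_of_ne_of_ne] at hb2
      · rw [Ne, Fin.mk.injEq]; omega
      · rw [Ne, Fin.mk.injEq]; omega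
  refine Finset.sum_involution (fun β hβ => sw β (Nat.find ((hmem β).1 hβ).2.2)) ?_ ?_ ?_ ?_
  · intro β hβ
    obtain ⟨hk, -⟩ := Nat.find_spec ((hmem β).1 hβ).2.2
    simp only [sw, dif_pos hk]
    rw [cf_comp_swap hG (by rw [Ne, Fin.mk.injEq]; omega), add_neg_cancel]
  · intro β hβ hne heq
    obtain ⟨hk, -⟩ := Nat.find_spec ((hmem β).1 hβ).2.2
    simp only [sw, dif_pos hk] at heq
    refine hne ?_
    have h1 := cf_comp_swap hG (i := ⟨Nat.find ((hmem β).1 hβ).2.2, by omega⟩)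
      (j := ⟨Nat.find ((hmem β).1 hβ).2.2 + 1, hk⟩) (by rw [Ne, Fin.mk.injEq]; omega) β
    rw [heq] at h1
    exact self_eq_neg.1 h1
  · intro β hβ
    obtain ⟨hle, hsum, hb⟩ := (hmem β).1 hβ
    obtain ⟨h1, h2, -⟩ := hfind β hb hle
    refine (hmem _).2 ⟨h1, ?_, h2⟩
    obtain ⟨hk, -⟩ := Nat.find_spec hb
    simp only [sw, dif_pos hk]
    refine Eq.trans ?_ hsum
    congr 1
    exact Equiv.sum_comp _ β
  · intro β hβ
    obtain ⟨hle, hsum, hb⟩ := (hmem β).1 hβ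
    obtain ⟨h1, h2, h3⟩ := hfind β hb hle
    obtain ⟨hk, -⟩ := Nat.find_spec hb
    have : sw (sw β (Nat.find hb)) (Nat.find hb) = β := by
      simp only [sw, dif_pos hk]
      ext i
      simp
    rw [h3]
    exact this

/-- Pieri's rule for complete homogeneous symmetric polynomials. -/
theorem cf_shift_mul_hPoly {G : MvPolynomial (Fin N) ℂ} (hG : IsAlternating G)
    {l : Fin N → ℕ} (hl : Antitone l) (r : ℕ) :
    cf (G * hPoly N r) (shift l) = ∑ μ ∈ hStrips l r, cf G (shift μ) := by
  classical
  have hv : Antitone (shift l) := by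
    intro i j hij
    have := hl hij
    rw [Fin.le_def] at hij
    simp only [shift]
    omega
  rw [cf_mul_hPoly, ← Finset.sum_filter_add_sum_filter_not _ (fun β : Fin N → ℕ =>
    ∃ (k : ℕ) (h : k + 1 < N), β ⟨k, by omega⟩ ≤ shift l ⟨k + 1, h⟩), Finset.filter_filter,
    sum_not_interlacing_eq_zero hG hv r, zero_add, Finset.filter_filter]
  symm
  refine Finset.sum_bij (fun μ _ => shift μ) ?_ ?_ ?_ (fun _ _ => rfl)
  · intro μ hμ
    obtain ⟨h1, h2, h3⟩ := mem_hStrips.1 hμ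
    simp only [Finset.mem_filter, Fintype.mem_piFinset, Finset.mem_range, sum_shift_add]
    refine ⟨fun i => ?_, by omega, ?_⟩
    · have := h1 i
      simp only [shift]
      omega
    · rintro ⟨k, hk, hle⟩
      have := h2 ⟨k, by omega⟩ ⟨k + 1, hk⟩ (by rw [Fin.lt_def]; simp)
      simp only [shift] at hle
      omega
  · intro μ _ μ' _ h
    ext i
    have := congrFun h i
    simp only [shift] at this
    omega
  · intro β hβ
    simp only [Finset.mem_filter, Fintype.mem_piFinset, Finset.mem_range, sum_shift_add,
      not_exists, not_le] at hβ
    obtain ⟨h1, h2, h3⟩ := hβ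
    -- Surviving exponents interlace strictly with `l + δ`, hence are strictly decreasing and of the
    -- form `μ + δ` with `l / μ` a horizontal strip.
    have hlt : ∀ i j : Fin N, i < j → shift l j < β i := by
      intro i j hij
      rw [Fin.lt_def] at hij
      have hi : (i : ℕ) + 1 < N := by have := j.2; omega
      exact (hv (by rw [Fin.le_def]; simp only; omega : (⟨i + 1, hi⟩ : Fin N) ≤ j)).trans_lt
        (h3 i hi)
    have hanti : StrictAnti β := fun i j hij =>
      (Nat.lt_succ_iff.1 (h1 j)).trans_lt (hlt i j hij)
    obtain ⟨μ, hμ, rfl⟩ := exists_shift_eq hanti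
    refine ⟨μ, mem_hStrips.2 ⟨fun i => ?_, fun i j hij => ?_, ?_⟩, rfl⟩
    · have := h1 i
      simp only [shift] at this
      omega
    · have hi : (i : ℕ) + 1 < N := by rw [Fin.lt_def] at hij; have := j.2; omega
      have h4 : shift l ⟨i + 1, hi⟩ < shift μ i := h3 i hi
      have h5 := hl (by rw [Fin.lt_def] at hij; rw [Fin.le_def]; simp only; omega :
        (⟨i + 1, hi⟩ : Fin N) ≤ j)
      simp only [shift] at h4
      omega
    · rw [sum_shift_add] at h2
      omega

end Alternating

/-! ### Complete and elementary symmetric polynomials as exponentials of power sums -/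

section SymmetricPolynomials

variable {N : ℕ}

theorem cycleExp_psum (r : ℕ) : cycleExp (psum (Fin N) ℂ) r = hPoly N r := by
  have h : psum (Fin N) ℂ = ∑ v : Fin N, fun k => (X v : MvPolynomial (Fin N) ℂ) ^ k := by
    ext1 k
    rw [psum, Finset.sum_apply]
  rw [← coeff_expSeries, h, expSeries_sum, PowerSeries.coeff_prod, hPoly]
  refine Finset.sum_congr rfl fun d _ => ?_
  rw [monomial_eq, map_one, one_mul, Finsupp.prod_fintype _ _ (by simp)]
  exact Finset.prod_congr rfl fun v _ => by rw [expSeries_pow, PowerSeries.coeff_mk]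

theorem expSeries_neg_psum (s : ℂ) :
    expSeries (fun k => -(-s) ^ k • psum (Fin N) ℂ k) =
      ∏ v : Fin N, (1 + PowerSeries.C (s • (X v : MvPolynomial (Fin N) ℂ)) * PowerSeries.X) := by
  have h : (fun k => -(-s) ^ k • psum (Fin N) ℂ k) =
      ∑ v : Fin N, fun k => -(-(s • (X v : MvPolynomial (Fin N) ℂ))) ^ k := by
    ext1 k
    rw [psum, Finset.sum_apply, Finset.smul_sum]
    exact Finset.sum_congr rfl fun v _ => by rw [← neg_smul, smul_pow, neg_smul]
  rw [h, expSeries_sum]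
  exact Finset.prod_congr rfl fun v _ => expSeries_neg_pow _

theorem cycleExp_neg_psum (s : ℂ) (r : ℕ) :
    cycleExp (fun k => -(-s) ^ k • psum (Fin N) ℂ k) r = s ^ r • esymm (Fin N) ℂ r := by
  rw [← coeff_expSeries, expSeries_neg_psum, Finset.prod_one_add, map_sum]
  have hterm : ∀ S : Finset (Fin N), PowerSeries.coeff r
      (∏ v ∈ S, PowerSeries.C (s • (X v : MvPolynomial (Fin N) ℂ)) * PowerSeries.X) =
      if #S = r then s ^ r • ∏ v ∈ S, X v else 0 := by
    intro S
    rw [Finset.prod_mul_distrib, Finset.prod_const, ← map_prod, PowerSeries.coeff_C_mul,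
      PowerSeries.coeff_X_pow]
    by_cases h : #S = r
    · rw [if_pos h.symm, if_pos h, mul_one, ← h, ← Finset.prod_const, Finset.prod_smul]
    · rw [if_neg (Ne.symm h), if_neg h, mul_zero]
  rw [Finset.sum_congr rfl fun S _ => hterm S, ← Finset.sum_filter, esymm, Finset.smul_sum,
    Finset.powersetCard_eq_filter]

theorem cycleExp_isSymmetric {P : ℕ → MvPolynomial (Fin N) ℂ} (hP : ∀ k, (P k).IsSymmetric)
    (m : ℕ) : (cycleExp P m).IsSymmetric := by
  intro e
  rw [cycleExp, map_sum]
  refine Finset.sum_congr rfl fun π _ => ?_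
  rw [map_smul, map_multiset_prod, Multiset.map_map]
  congr 2
  exact Multiset.map_congr rfl fun k _ => hP k e

theorem hPoly_isSymmetric (r : ℕ) : (hPoly N r).IsSymmetric := by
  rw [← cycleExp_psum]
  exact cycleExp_isSymmetric (psum_isSymmetric (Fin N) ℂ) r

end SymmetricPolynomials

/-! ### Dominance triangularity of iterated Pieri products -/

section Triangularity

variable {N : ℕ}

theorem isAlternating_mul_prod {ι : Type*} (s : Finset ι) (F : ι → MvPolynomial (Fin N) ℂ)
    (hF : ∀ i, (F i).IsSymmetric) : IsAlternating (alternant N * ∏ i ∈ s, F i) := by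
  refine isAlternating_alternant.mul fun e => ?_
  rw [map_prod]
  exact Finset.prod_congr rfl fun i _ => hF i e

/-- A horizontal strip of size `r` has at most one cell in each column, so at most `min r m` cells
in the first `m` columns. -/
theorem sum_min_le_of_mem_hStrips {l μ : Fin N → ℕ} {r : ℕ} (h : μ ∈ hStrips l r) (m : ℕ) :
    ∑ i, min (l i) m ≤ ∑ i, min (μ i) m + min r m := by
  obtain ⟨h1, h2, h3⟩ := mem_hStrips.1 h
  have hr : ∑ i, min (l i) m ≤ ∑ i, min (μ i) m + r := by
    have : ∑ i, min (l i) m + ∑ i, μ i ≤ ∑ i, min (μ i) m + ∑ i, l i := by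
      rw [← Finset.sum_add_distrib, ← Finset.sum_add_distrib]
      refine Finset.sum_le_sum fun i _ => ?_
      have := h1 i
      omega
    omega
  have hm : ∑ i, min (l i) m ≤ ∑ i, min (μ i) m + m := by
    cases N with
    | zero => simp
    | succ N =>
      rw [Fin.sum_univ_succ, Fin.sum_univ_castSucc (fun i => min (μ i) m)]
      have : ∑ i : Fin N, min (l i.succ) m ≤ ∑ i : Fin N, min (μ i.castSucc) m :=
        Finset.sum_le_sum fun i _ => min_le_min_right m (h2 _ _ Fin.castSucc_lt_succ)
      have := min_le_right (l 0) m
      omega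
  omega

/-- The product of the alternant and complete homogeneous symmetric polynomials. -/
noncomputable def altH (N : ℕ) (ν : ℕ → ℕ) (k : ℕ) : MvPolynomial (Fin N) ℂ :=
  alternant N * ∏ j ∈ range k, hPoly N (ν j)

theorem isAlternating_altH (ν : ℕ → ℕ) (k : ℕ) : IsAlternating (altH N ν k) :=
  isAlternating_mul_prod _ _ fun _ => hPoly_isSymmetric _

theorem altH_succ (ν : ℕ → ℕ) (k : ℕ) : altH N ν (k + 1) = altH N ν k * hPoly N (ν k) := by
  rw [altH, altH, Finset.prod_range_succ, mul_assoc]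

/-- A contributing shape is built from the empty one by `k` horizontal strips of sizes `ν j`. Each
strip adds at most one row, and its cells in the first `m` columns are bounded as above. The row
bound is needed for `cf_altH_self`. -/
theorem cf_altH_ne_zero (ν : ℕ → ℕ) (k : ℕ) : ∀ {l : Fin N → ℕ}, Antitone l →
    cf (altH N ν k) (shift l) ≠ 0 →
    (∀ m, ∑ i, min (l i) m ≤ ∑ j ∈ range k, min (ν j) m) ∧ ∀ i : Fin N, k ≤ i → l i = 0 := by
  induction k with
  | zero =>
    intro l _ hne
    rw [altH, Finset.prod_range_zero, mul_one, cf_alternant] at hne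
    have : l = 0 := by
      by_contra h
      exact hne (if_neg h)
    simp [this]
  | succ k ih =>
    intro l hl hne
    rw [altH_succ, cf_shift_mul_hPoly (isAlternating_altH ν k) hl] at hne
    obtain ⟨μ, hμ, hμne⟩ := Finset.exists_ne_zero_of_sum_ne_zero hne
    obtain ⟨h1, h2⟩ := ih (antitone_of_mem_hStrips hμ) hμne
    refine ⟨fun m => ?_, fun i hi => ?_⟩
    · rw [Finset.sum_range_succ]
      exact (sum_min_le_of_mem_hStrips hμ m).trans (Nat.add_le_add_right (h1 m) _)
    · have hi' : (i : ℕ) - 1 < N := by have := i.2; omega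
      have h3 := (mem_hStrips.1 hμ).2.1 ⟨i - 1, hi'⟩ i (by rw [Fin.lt_def]; simp only; omega)
      rw [h2 ⟨i - 1, hi'⟩ (by simp only; omega)] at h3
      omega

theorem cf_altH_self {ν : ℕ → ℕ} (hν : Antitone ν) (k : ℕ) (hk : k ≤ N) :
    cf (altH N ν k) (shift fun i => if (i : ℕ) < k then ν i else 0) = 1 := by
  induction k with
  | zero =>
    rw [altH, Finset.prod_range_zero, mul_one, cf_alternant]
    exact if_pos (by ext i; simp)
  | succ k ih =>
    have hanti : ∀ k : ℕ, Antitone fun i : Fin N => if (i : ℕ) < k then ν i else 0 := by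
      intro k i j hij
      have := hν (Fin.le_def.1 hij)
      rw [Fin.le_def] at hij
      simp only
      split_ifs <;> omega
    have hkN : k < N := hk
    have hsum : ∑ i : Fin N, (if (i : ℕ) < k then ν i else 0) + ν k =
        ∑ i : Fin N, if (i : ℕ) < k + 1 then ν i else 0 := by
      have hsingle : ν k = ∑ i : Fin N, if i = ⟨k, hkN⟩ then ν i else 0 := by simp
      rw [hsingle, ← Finset.sum_add_distrib]
      refine Finset.sum_congr rfl fun i _ => ?_
      rcases lt_trichotomy (i : ℕ) k with h | h | h
      · rw [if_pos h, if_neg (by rintro rfl; simp at h), if_pos (by omega), add_zero]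
      · rw [if_neg (by omega), if_pos (Fin.ext h), if_pos (by omega), zero_add]
      · rw [if_neg (by omega), if_neg (by rintro rfl; simp at h), if_neg (by omega)]
    rw [altH_succ, cf_shift_mul_hPoly (isAlternating_altH ν k) (hanti _),
      Finset.sum_eq_single fun i : Fin N => if (i : ℕ) < k then ν i else 0]
    · exact ih hkN.le
    -- Any other contributing `μ` has at most `k` rows and lies inside the truncation of `ν` to `k`
    -- rows; equality of sizes then forces equality.
    · intro μ hμ hne
      by_contra hcf
      obtain ⟨-, h2⟩ := cf_altH_ne_zero ν k (antitone_of_mem_hStrips hμ) hcf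
      obtain ⟨h3, -, h5⟩ := mem_hStrips.1 hμ
      rw [← hsum] at h5
      have hle : ∀ i ∈ (univ : Finset (Fin N)), μ i ≤ if (i : ℕ) < k then ν i else 0 := by
        intro i _
        split_ifs with hi
        · have := h3 i
          rwa [if_pos (by omega)] at this
        · exact (h2 i (by omega)).le
      refine hne (funext fun i => ?_)
      exact (Finset.sum_eq_sum_iff_of_le hle).1 (by omega) i (Finset.mem_univ i)
    · intro hnot
      refine absurd (mem_hStrips.2 ⟨fun i => ?_, fun i j hij => ?_, hsum⟩) hnot
      · split_ifs <;> omega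
      · have := hν (Fin.lt_def.1 hij).le
        rw [Fin.lt_def] at hij
        split_ifs <;> omega

/-- The product of the alternant and elementary symmetric polynomials. -/
noncomputable def altE (N : ℕ) (κ : ℕ → ℕ) (k : ℕ) : MvPolynomial (Fin N) ℂ :=
  alternant N * ∏ j ∈ range k, esymm (Fin N) ℂ (κ j)

theorem isAlternating_altE (κ : ℕ → ℕ) (k : ℕ) : IsAlternating (altE N κ k) :=
  isAlternating_mul_prod _ _ fun _ => esymm_isSymmetric _ _ _

theorem altE_succ (κ : ℕ → ℕ) (k : ℕ) :
    altE N κ (k + 1) = altE N κ k * esymm (Fin N) ℂ (κ k) := by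
  rw [altE, altE, Finset.prod_range_succ, mul_assoc]

theorem cf_mul_esymm (G : MvPolynomial (Fin N) ℂ) (r : ℕ) (v : Fin N → ℕ) :
    cf (G * esymm (Fin N) ℂ r) v = ∑ S ∈ powersetCard r univ, cf (G * ∏ i ∈ S, X i) v := by
  rw [cf, esymm, Finset.mul_sum, coeff_sum]
  rfl

/-- Nonzero terms in the multiplication by an elementary symmetric polynomial come from vertical
strips. -/
theorem exists_of_cf_mul_prod_X_ne_zero {G : MvPolynomial (Fin N) ℂ} (hG : IsAlternating G)
    {l : Fin N → ℕ} (hl : Antitone l) {S : Finset (Fin N)}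
    (hne : cf (G * ∏ i ∈ S, X i) (shift l) ≠ 0) :
    ∃ μ : Fin N → ℕ, Antitone μ ∧ (∀ i, l i = μ i + if i ∈ S then 1 else 0) ∧
      cf (G * ∏ i ∈ S, X i) (shift l) = cf G (shift μ) := by
  rw [cf_mul_prod_X] at hne ⊢
  have hS : ∀ i ∈ S, 1 ≤ shift l i := by
    by_contra h
    exact hne (if_neg h)
  rw [if_pos hS] at hne ⊢
  have hinj : Function.Injective fun i => shift l i - if i ∈ S then 1 else 0 := by
    by_contra h
    exact hne (cf_eq_zero hG h)
  obtain ⟨μ, h1, h2, h3⟩ := exists_vertical_strip hl hinj hS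
  exact ⟨μ, h1, h2, by rw [h3]⟩

theorem cf_mul_prod_X_of_eq {G : MvPolynomial (Fin N) ℂ} {l μ : Fin N → ℕ} {S : Finset (Fin N)}
    (h : ∀ i, l i = μ i + if i ∈ S then 1 else 0) :
    cf (G * ∏ i ∈ S, X i) (shift l) = cf G (shift μ) := by
  rw [cf_mul_prod_X, if_pos fun i hi => by rw [shift, h i, if_pos hi]; omega]
  congr 1
  ext i
  rw [shift, shift, h i]
  omega

/-- A contributing shape is built by `k` vertical strips, each lengthening a row by at most one.
After `m` strips the shape therefore fits into the first `m` columns, and it is contained in `l`. -/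
theorem cf_altE_ne_zero (κ : ℕ → ℕ) (k : ℕ) : ∀ {l : Fin N → ℕ}, Antitone l →
    cf (altE N κ k) (shift l) ≠ 0 → (∀ i, l i ≤ k) ∧ ∑ i, l i = ∑ j ∈ range k, κ j ∧
      ∀ m ≤ k, ∑ j ∈ range m, κ j ≤ ∑ i, min (l i) m := by
  induction k with
  | zero =>
    intro l _ hne
    rw [altE, Finset.prod_range_zero, mul_one, cf_alternant] at hne
    have : l = 0 := by
      by_contra h
      exact hne (if_neg h)
    simp [this]
  | succ k ih =>
    intro l hl hne
    rw [altE_succ, cf_mul_esymm] at hne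
    obtain ⟨S, hS, hSne⟩ := Finset.exists_ne_zero_of_sum_ne_zero hne
    obtain ⟨μ, hμ, hlμ, heq⟩ := exists_of_cf_mul_prod_X_ne_zero (isAlternating_altE κ k) hl hSne
    rw [heq] at hSne
    obtain ⟨h1, h2, h3⟩ := ih hμ hSne
    have hle : ∀ i, l i ≤ k + 1 := by
      intro i
      have := h1 i
      rw [hlμ i]
      split_ifs <;> omega
    have hsum : ∑ i, l i = ∑ j ∈ range (k + 1), κ j := by
      rw [Finset.sum_congr rfl fun i _ => hlμ i, Finset.sum_add_distrib, h2,
        Finset.sum_range_succ, ← (Finset.mem_powersetCard.1 hS).2]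
      simp
    refine ⟨hle, hsum, fun m hm => ?_⟩
    rcases hm.lt_or_eq with hlt | rfl
    · refine (h3 m (by omega)).trans (Finset.sum_le_sum fun i _ => min_le_min_right m ?_)
      rw [hlμ i]
      omega
    · rw [← hsum]
      exact (Finset.sum_congr rfl fun i _ => (min_eq_left (hle i)).symm).le

/-- The strip sizes are the column lengths of `l`. The shape before the last strip has at most `k`
columns, so that strip must contain all of column `k`; by size it is exactly that column, and only
one term survives. -/
theorem cf_altE_self {l : Fin N → ℕ} (hl : Antitone l) (k : ℕ) :
    cf (altE N (fun j => #{i | j < l i}) k) (shift fun i => min (l i) k) = 1 := by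
  induction k with
  | zero =>
    rw [altE, Finset.prod_range_zero, mul_one, cf_alternant]
    exact if_pos (by ext i; simp)
  | succ k ih =>
    have hanti : Antitone fun i => min (l i) (k + 1) := fun i j hij => min_le_min_right _ (hl hij)
    have hstep : ∀ i, min (l i) (k + 1) =
        min (l i) k + if i ∈ ({i | k < l i} : Finset (Fin N)) then 1 else 0 := by
      intro i
      simp only [Finset.mem_filter, Finset.mem_univ, true_and]
      split_ifs <;> omega
    rw [altE_succ, cf_mul_esymm, Finset.sum_eq_single ({i | k < l i} : Finset (Fin N)),
      cf_mul_prod_X_of_eq hstep, ih]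
    · intro S hS hne
      by_contra hcf
      obtain ⟨μ, hμ, hlμ, heq⟩ := exists_of_cf_mul_prod_X_ne_zero (isAlternating_altE _ k) hanti hcf
      rw [heq] at hcf
      obtain ⟨h1, -, -⟩ := cf_altE_ne_zero _ k hμ hcf
      refine hne (Finset.eq_of_subset_of_card_le (fun i hi => ?_) ?_).symm
      · have hi' : k < l i := by simpa using hi
        by_contra hiS
        have h4 := hlμ i
        have h5 := h1 i
        rw [if_neg hiS] at h4
        omega
      · exact (Finset.mem_powersetCard.1 hS).2.le
    · intro h
      exact absurd (Finset.mem_powersetCard.2 ⟨Finset.subset_univ _, rfl⟩) h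

end Triangularity

/-! ### Uniqueness from two opposite triangularities -/

section LinearAlgebra

variable {ι Q : Type*} [Fintype ι] [PartialOrder Q]

/-- Back substitution from the bottom of the order. The set `T` on which the equations are known
only has to be closed downwards. -/
theorem eq_zero_of_triangular {q : ι → Q} (hq : Function.Injective q) {M : ι → ι → ℂ}
    (hM : ∀ μ ν, ¬ q μ ≤ q ν → M μ ν = 0) (hdiag : ∀ ν, M ν ν ≠ 0) {T : ι → Prop}
    (hT : ∀ μ ν, q μ ≤ q ν → T ν → T μ) {c : ι → ℂ}
    (hc : ∀ ν, T ν → ∑ μ, c μ * M μ ν = 0) (ν : ι) (hν : T ν) : c ν = 0 := by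
  have : IsTrans ι fun a b => q a < q b := ⟨fun _ _ _ h1 h2 => h1.trans h2⟩
  have : Std.Irrefl fun a b : ι => q a < q b := ⟨fun _ h => lt_irrefl _ h⟩
  induction ν using (Finite.wellFounded_of_trans_of_irrefl fun a b => q a < q b).induction with
  | _ ν ih =>
    have h := hc ν hν
    rw [Finset.sum_eq_single ν] at h
    · exact (mul_eq_zero.1 h).resolve_right (hdiag ν)
    · intro μ _ hne
      by_cases hle : q μ ≤ q ν
      · rw [ih μ (lt_of_le_of_ne hle fun he => hne (hq he)) (hT μ ν hle hν), zero_mul]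
      · rw [hM μ ν hle, mul_zero]
    · simp

/-- Two families of vectors that are triangular with respect to two families of functionals, in
opposite directions, agree if they agree on the diagonal. -/
theorem eq_of_doubly_triangular {q : ι → Q} (hq : Function.Injective q)
    {χ ψ : ι → ι → ℂ} {H E : ι → (ι → ℂ) →ₗ[ℂ] ℂ}
    (hχH : ∀ μ ν, ¬ q μ ≤ q ν → H ν (χ μ) = 0) (hχ1 : ∀ ν, H ν (χ ν) = 1)
    (hψH : ∀ μ ν, ¬ q μ ≤ q ν → H ν (ψ μ) = 0) (hψ1 : ∀ ν, H ν (ψ ν) = 1)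
    (hχE : ∀ μ ν, ¬ q ν ≤ q μ → E ν (χ μ) = 0)
    (hψE : ∀ μ ν, ¬ q ν ≤ q μ → E ν (ψ μ) = 0) (hψE1 : ∀ ν, E ν (ψ ν) ≠ 0) : χ = ψ := by
  have hli : LinearIndependent ℂ ψ := by
    rw [Fintype.linearIndependent_iff]
    intro c hc ν
    refine eq_zero_of_triangular hq (M := fun μ ν => H ν (ψ μ)) hψH
      (fun ν => by rw [hψ1]; exact one_ne_zero) (T := fun _ => True) (fun _ _ _ h => h) (c := c)
      (fun ν _ => ?_) ν trivial
    have := congrArg (H ν) hc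
    simpa using this
  have hspan := hli.span_eq_top_of_card_eq_finrank' (by simp)
  -- Expand `χ lam` in the basis `ψ`. The functionals `H` confine the coefficients to indices above
  -- `lam`, the functionals `E` to indices below it, and `H lam` normalizes the remaining one.
  ext1 lam
  obtain ⟨t, ht⟩ := (Submodule.mem_span_range_iff_exists_fun ℂ).1
    (hspan ▸ Submodule.mem_top : χ lam ∈ Submodule.span ℂ (Set.range ψ))
  have hH : ∀ ν, ∑ μ, t μ * H ν (ψ μ) = H ν (χ lam) := fun ν => by
    rw [← ht, map_sum]
    simp
  have hE : ∀ ν, ∑ μ, t μ * E ν (ψ μ) = E ν (χ lam) := fun ν => by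
    rw [← ht, map_sum]
    simp
  have h1 : ∀ ν, ¬ q lam ≤ q ν → t ν = 0 :=
    eq_zero_of_triangular hq (M := fun μ ν => H ν (ψ μ)) hψH
      (fun ν => by rw [hψ1]; exact one_ne_zero) (fun μ ν hle h h' => h (h'.trans hle))
      fun ν hν => by rw [hH, hχH lam ν hν]
  have h2 : ∀ ν, ¬ q ν ≤ q lam → t ν = 0 :=
    eq_zero_of_triangular (Q := Qᵒᵈ) (q := fun ν => OrderDual.toDual (q ν))
      (fun a b h => hq h) (M := fun μ ν => E ν (ψ μ)) hψE hψE1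
      (fun μ ν hle h h' => h (le_trans hle h')) fun ν hν => by rw [hE, hχE lam ν hν]
  have h0 : ∀ ν, ν ≠ lam → t ν = 0 := by
    intro ν hne
    by_cases hle : q lam ≤ q ν
    · exact h2 ν fun hle' => hne (hq (le_antisymm hle' hle))
    · exact h1 ν hle
  have ht1 : t lam = 1 := by
    have := hH lam
    rwa [hχ1, Finset.sum_eq_single lam (fun μ _ hne => by rw [h0 μ hne, zero_mul]) (by simp), hψ1,
      mul_one] at this
  rw [← ht, Finset.sum_eq_single lam (fun μ _ hne => by rw [h0 μ hne, zero_smul]) (by simp), ht1,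
    one_smul]

end LinearAlgebra

/-! ### The Frobenius character formula -/

section Frobenius

variable {n : ℕ} (N : ℕ)

/-- The row lengths of a partition, as a function on the first `N` indices. -/
def rowFun (lam : Nat.Partition n) (i : Fin N) : ℕ := (diagram lam).rowLen i

theorem rowFun_antitone (lam : Nat.Partition n) : Antitone (rowFun N lam) := fun _ _ hij =>
  (diagram lam).rowLen_anti _ _ (Fin.le_def.1 hij)

theorem colLen_le (lam : Nat.Partition n) (j : ℕ) : (diagram lam).colLen j ≤ n := by
  rw [← card_colOf]
  exact (Finset.card_le_univ _).trans (Fintype.card_fin n).le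

theorem rowLen_le (lam : Nat.Partition n) (j : ℕ) : (diagram lam).rowLen j ≤ n := by
  rw [← card_rowOf]
  exact (Finset.card_le_univ _).trans (Fintype.card_fin n).le

theorem rowOf_lt (lam : Nat.Partition n) (i : Fin n) : rowOf lam i < n :=
  (YoungDiagram.mem_iff_lt_colLen.1
    ((YoungDiagram.mem_cells _).1 ((tableau lam).symm i).2)).trans_le (colLen_le lam _)

theorem colOf_lt (lam : Nat.Partition n) (i : Fin n) : colOf lam i < n :=
  (colOf_lt_rowLen lam i).trans_le (rowLen_le lam _)

variable {N}

theorem colWeight_eq_sum_min (hN : n ≤ N) (lam : Nat.Partition n) (m : ℕ) :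
    colWeight lam m = ∑ k ∈ range N, min ((diagram lam).rowLen k) m := by
  rw [colWeight_eq, Finset.card_eq_sum_card_fiberwise (f := rowOf lam) (t := range N)
    (fun i _ => by simpa using (rowOf_lt lam i).trans_le hN)]
  refine Finset.sum_congr rfl fun k _ => ?_
  rw [← card_rowOf_colOf_lt]
  congr 1
  ext i
  simp [and_comm]

theorem colWeight_eq_sum_rowFun (hN : n ≤ N) (lam : Nat.Partition n) (m : ℕ) :
    colWeight lam m = ∑ i, min (rowFun N lam i) m := by
  rw [colWeight_eq_sum_min hN, Finset.sum_range]
  rfl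

theorem sum_rowFun (hN : n ≤ N) (lam : Nat.Partition n) : ∑ i, rowFun N lam i = n := by
  have h := colWeight_eq_sum_rowFun hN lam n
  rw [colWeight_eq, Finset.filter_true_of_mem fun i _ => colOf_lt lam i, Finset.card_univ,
    Fintype.card_fin] at h
  conv_rhs => rw [h]
  exact Finset.sum_congr rfl fun i _ => (min_eq_left (rowLen_le lam i)).symm

theorem colWeight_le (lam : Nat.Partition n) (m : ℕ) : colWeight lam m ≤ n := by
  rw [colWeight_eq]
  exact (Finset.card_le_univ _).trans (Fintype.card_fin n).le

theorem colWeight_eq_sum_colLen (lam : Nat.Partition n) (m : ℕ) :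
    colWeight lam m = ∑ j ∈ range m, (diagram lam).colLen j := by
  induction m with
  | zero => simp [colWeight]
  | succ m ih => rw [Finset.sum_range_succ, colWeight_succ, ih]

theorem card_lt_rowFun (hN : n ≤ N) (lam : Nat.Partition n) (j : ℕ) :
    #{i | j < rowFun N lam i} = (diagram lam).colLen j := by
  have : (univ.filter fun i => j < rowFun N lam i) =
      univ.filter fun i : Fin N => (i : ℕ) < (diagram lam).colLen j := by
    ext i
    simp [rowFun, ← YoungDiagram.mem_iff_lt_rowLen, YoungDiagram.mem_iff_lt_colLen]
  rw [this, Fin.card_filter_val_lt, min_eq_right ((colLen_le lam j).trans hN)]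

/-- The cycle type of a permutation of `Fin n`, as a partition of `n`. -/
def permType (g : Equiv.Perm (Fin n)) : Nat.Partition n where
  parts := g.partition.parts
  parts_pos := g.partition.parts_pos
  parts_sum := g.partition.parts_sum.trans (Fintype.card_fin n)

theorem chi_permType (lam : Nat.Partition n) (g : Equiv.Perm (Fin n)) :
    chi lam (permType g) = (spechtRep lam).character g := chi_eq lam _ g rfl

variable (N) in
/-- The coefficient of `x^{λ + δ}` in the product of the alternant and a power sum product. -/
noncomputable def psi (lam π : Nat.Partition n) : ℂ :=
  cf (alternant N * (π.parts.map (psum (Fin N) ℂ)).prod) (shift (rowFun N lam))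

theorem cf_sum {ι : Type*} (s : Finset ι) (F : ι → MvPolynomial (Fin N) ℂ) (v : Fin N → ℕ) :
    cf (∑ i ∈ s, F i) v = ∑ i ∈ s, cf (F i) v := coeff_sum _ _ _

theorem cf_smul (c : ℂ) (F : MvPolynomial (Fin N) ℂ) (v : Fin N → ℕ) :
    cf (c • F) v = c * cf F v := coeff_smul _ _ _

theorem prod_parts_neg_one (g : Equiv.Perm (Fin n)) :
    (g.partition.parts.map fun k => -(-1 : ℂ) ^ k).prod = ((Equiv.Perm.sign g : ℤ) : ℂ) := by
  have h : ∀ m : Multiset ℕ, (m.map fun k => -(-1 : ℂ) ^ k).prod = (-1) ^ (m.sum + m.card) := by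
    intro m
    induction m using Multiset.induction_on with
    | empty => simp
    | cons a m ih =>
      rw [Multiset.map_cons, Multiset.prod_cons, ih, Multiset.sum_cons, Multiset.card_cons]
      ring
  rw [Equiv.Perm.parts_partition, Multiset.map_add, Multiset.prod_add, h,
    Equiv.Perm.sign_of_cycleType]
  simp

theorem prod_map_smul (m : Multiset ℕ) (c : ℕ → ℂ) (p : ℕ → MvPolynomial (Fin N) ℂ) :
    (m.map fun k => c k • p k).prod = (m.map c).prod • (m.map p).prod := by
  induction m using Multiset.induction_on with
  | empty => simp
  | cons a m ih =>
    rw [Multiset.map_cons, Multiset.map_cons, Multiset.map_cons, Multiset.prod_cons,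
      Multiset.prod_cons, Multiset.prod_cons, ih, smul_mul_smul_comm]

/-- Averaging power sum products over a Young subgroup factors over the rows, each row of length `r`
contributing `h_r`. -/
theorem sum_row_psi (hN : n ≤ N) (lam nu : Nat.Partition n) :
    ∑ g : Equiv.Perm (Fin n) with ∀ i, rowOf nu (g i) = rowOf nu i, psi N lam (permType g) =
      rowCard nu * cf (altH N (diagram nu).rowLen N) (shift (rowFun N lam)) := by
  have hlt : ∀ i, rowOf nu i < N := fun i => (rowOf_lt nu i).trans_le hN
  have h := sum_stabilizer_prod_parts (psum (Fin N) ℂ) N (Fin n) (rowOf nu) hlt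
  have hcard := card_stabilizer_fibers (rowOf nu) hlt
  simp only [card_rowOf, cycleExp_psum] at h hcard
  rw [Finset.prod_smul, ← Nat.cast_prod, ← hcard] at h
  simp only [psi, permType]
  rw [← cf_sum, ← Finset.mul_sum]
  have h' : ∑ g : Equiv.Perm (Fin n) with ∀ i, rowOf nu (g i) = rowOf nu i,
      (g.partition.parts.map (psum (Fin N) ℂ)).prod =
        (rowCard nu : ℂ) • ∏ i ∈ range N, hPoly N ((diagram nu).rowLen i) := by
    rw [rowCard]
    convert h
    rfl
  rw [h', mul_smul_comm, cf_smul]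
  rfl

/-- The sign is `-(-1)^k` per cycle of length `k`; absorbed into the power sums, it turns the
contribution of a column of length `r` into `e_r`. -/
theorem sum_col_psi (hN : n ≤ N) (lam nu : Nat.Partition n) :
    ∑ g : Equiv.Perm (Fin n) with ∀ i, colOf nu (g i) = colOf nu i,
      ((Equiv.Perm.sign g : ℤ) : ℂ) * psi N lam (permType g) =
      colCard nu * cf (altE N (diagram nu).colLen N) (shift (rowFun N lam)) := by
  have hlt : ∀ i, colOf nu i < N := fun i => (colOf_lt nu i).trans_le hN
  have h := sum_stabilizer_prod_parts (fun k => -(-1 : ℂ) ^ k • psum (Fin N) ℂ k) N (Fin n)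
    (colOf nu) hlt
  have hcard := card_stabilizer_fibers (colOf nu) hlt
  simp only [card_colOf, cycleExp_neg_psum, one_pow, one_smul] at h hcard
  rw [Finset.prod_smul, ← Nat.cast_prod, ← hcard] at h
  have hterm : ∀ g : Equiv.Perm (Fin n), ((Equiv.Perm.sign g : ℤ) : ℂ) * psi N lam (permType g) =
      cf (alternant N * (g.partition.parts.map fun k => -(-1 : ℂ) ^ k • psum (Fin N) ℂ k).prod)
        (shift (rowFun N lam)) := by
    intro g
    rw [psi, ← cf_smul, ← prod_parts_neg_one g, ← mul_smul_comm]
    rw [prod_map_smul]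
    rfl
  have h' : ∑ g : Equiv.Perm (Fin n) with ∀ i, colOf nu (g i) = colOf nu i,
      (g.partition.parts.map fun k => -(-1 : ℂ) ^ k • psum (Fin N) ℂ k).prod =
        (colCard nu : ℂ) • ∏ i ∈ range N, esymm (Fin N) ℂ ((diagram nu).colLen i) := by
    rw [colCard]
    convert h
    rfl
  rw [Finset.sum_congr rfl fun g _ => hterm g, ← cf_sum, ← Finset.mul_sum, h', mul_smul_comm,
    cf_smul]
  rfl

/-- The Frobenius character formula: the characters of the Specht modules are the coefficients of
the products of power sums and the alternant. -/
theorem chi_eq_psi (hN : n ≤ N) (lam π : Nat.Partition n) : chi lam π = psi N lam π := by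
  have hr : ∀ nu : Nat.Partition n, (rowCard nu : ℂ) ≠ 0 := fun nu =>
    Nat.cast_ne_zero.2 (rowCard_ne_zero nu)
  have hc : ∀ nu : Nat.Partition n, (colCard nu : ℂ) ≠ 0 := fun nu =>
    Nat.cast_ne_zero.2 (colCard_ne_zero nu)
  let H : Nat.Partition n → (Nat.Partition n → ℂ) →ₗ[ℂ] ℂ := fun nu => (rowCard nu : ℂ)⁻¹ •
    ∑ g : Equiv.Perm (Fin n) with ∀ i, rowOf nu (g i) = rowOf nu i, LinearMap.proj (permType g)
  let E : Nat.Partition n → (Nat.Partition n → ℂ) →ₗ[ℂ] ℂ := fun nu =>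
    ∑ g : Equiv.Perm (Fin n) with ∀ i, colOf nu (g i) = colOf nu i,
      ((Equiv.Perm.sign g : ℤ) : ℂ) • LinearMap.proj (permType g)
  have hHχ : ∀ mu nu, H nu (chi mu) = (rowCard nu : ℂ)⁻¹ * spechtTrace mu (rowSymmetrizer nu) := by
    intro mu nu
    simp [H, spechtTrace_rowSymmetrizer, chi_permType]
  have hEχ : ∀ mu nu, E nu (chi mu) = spechtTrace mu (colAntisymmetrizer nu) := by
    intro mu nu
    simp [E, spechtTrace_colAntisymmetrizer, chi_permType]
  have hHψ : ∀ mu nu, H nu (psi N mu) =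
      cf (altH N (diagram nu).rowLen N) (shift (rowFun N mu)) := by
    intro mu nu
    have h := sum_row_psi hN mu nu
    simp only [H, LinearMap.smul_apply, LinearMap.sum_apply, LinearMap.proj_apply, smul_eq_mul]
    rw [h, inv_mul_cancel_left₀ (hr nu)]
  have hEψ : ∀ mu nu, E nu (psi N mu) =
      colCard nu * cf (altE N (diagram nu).colLen N) (shift (rowFun N mu)) := by
    intro mu nu
    rw [← sum_col_psi hN mu nu]
    simp [E]
  have hcol : ∀ nu : Nat.Partition n,
      (diagram nu).colLen = fun j => #{i | j < rowFun N nu i} := fun nu => by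
    ext1 j
    rw [card_lt_rowFun hN]
  have key : (chi : Nat.Partition n → Nat.Partition n → ℂ) = psi N := by
    refine eq_of_doubly_triangular (q := colWeight) colWeight_injective (H := H) (E := E)
      ?_ ?_ ?_ ?_ ?_ ?_ ?_
    · intro mu nu h
      rw [hHχ, spechtTrace_rowSymmetrizer_eq_zero mu nu h, mul_zero]
    · intro nu
      rw [hHχ, spechtTrace_rowSymmetrizer_self, inv_mul_cancel₀ (hr nu)]
    · intro mu nu h
      rw [hHψ]
      by_contra hne
      refine h fun m => ?_
      rw [colWeight_eq_sum_rowFun hN mu, colWeight_eq_sum_min hN nu]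
      exact (cf_altH_ne_zero _ N (rowFun_antitone N mu) hne).1 m
    · intro nu
      rw [hHψ]
      have h := cf_altH_self (N := N) (ν := (diagram nu).rowLen)
        (fun i j hij => (diagram nu).rowLen_anti i j hij) N le_rfl
      simp only [Fin.is_lt, if_true] at h
      exact h
    · intro mu nu h
      rw [hEχ, spechtTrace_colAntisymmetrizer_eq_zero mu nu h]
    · intro mu nu h
      rw [hEψ]
      by_contra hne
      refine h fun m => ?_
      obtain ⟨h1, h2, h3⟩ := cf_altE_ne_zero _ N (rowFun_antitone N mu) (right_ne_zero_of_mul hne)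
      -- The triangularity bound covers only `m ≤ N`; beyond that the first `m` columns already
      -- contain all `n` cells of `mu`.
      rcases le_total m N with hm | hm
      · rw [colWeight_eq_sum_rowFun hN mu, colWeight_eq_sum_colLen]
        exact h3 m hm
      · refine (colWeight_le nu m).trans ?_
        rw [colWeight_eq_sum_rowFun hN mu]
        conv_lhs => rw [← sum_rowFun hN mu]
        exact Finset.sum_le_sum fun i _ => le_min le_rfl ((h1 i).trans hm)
    · intro nu
      rw [hEψ, hcol]
      have h := cf_altE_self (rowFun_antitone N nu) N
      have hmin : (fun i => min (rowFun N nu i) N) = rowFun N nu := by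
        ext1 i
        exact min_eq_left ((rowLen_le nu i).trans hN)
      rw [hmin] at h
      rw [h, mul_one]
      exact hc nu
  rw [key]

end Frobenius

/-! ### Row lengths, multiplicities and the conjugate partition -/

section RowLengths

variable {n N : ℕ}

theorem rowLen_eq_zero (Y : YoungDiagram) {i : ℕ} (hi : Y.colLen 0 ≤ i) : Y.rowLen i = 0 := by
  by_contra h
  have := YoungDiagram.mem_iff_lt_colLen.1 (YoungDiagram.mem_iff_lt_rowLen.2 (Nat.pos_of_ne_zero h))
  omega

theorem sum_rowLens (Y : YoungDiagram) (hN : Y.colLen 0 ≤ N) :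
    Y.rowLens.sum = ∑ i : Fin N, Y.rowLen i := by
  rw [← Finset.sum_range, ← Finset.sum_subset (Finset.range_subset_range.2 hN)]
  · rfl
  · intro i _ hi
    exact rowLen_eq_zero Y (by simpa using hi)

/-- Every weakly decreasing sequence is the sequence of row lengths of a partition. -/
theorem exists_rowFun_eq {μ : Fin N → ℕ} (hμ : Antitone μ) {m : ℕ} (hm : ∑ i, μ i = m) :
    ∃ lam : Nat.Partition m, rowFun N lam = μ := by
  have hs : (List.ofFn μ).SortedGE := hμ.sortedGE_ofFn
  let Y := YoungDiagram.ofRowLens (List.ofFn μ) hs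
  have hrow : ∀ i : Fin N, Y.rowLen i = μ i := by
    intro i
    have h := YoungDiagram.rowLen_ofRowLens (w := List.ofFn μ) (hw := hs)
      (Fin.cast (List.length_ofFn).symm i)
    simpa using h
  have hcol : Y.colLen 0 ≤ N := by
    by_contra! h
    have h1 := YoungDiagram.mem_iff_lt_colLen.2 h
    obtain ⟨h2, -⟩ := YoungDiagram.mem_ofRowLens.1 h1
    simp at h2
  let lam : Nat.Partition m := ⟨Y.rowLens, fun {i} hi => Y.pos_of_mem_rowLens i hi, by
    rw [Multiset.sum_coe, sum_rowLens Y hcol, ← hm]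
    exact Finset.sum_congr rfl fun i _ => hrow i⟩
  have hlam : diagram lam = Y := by
    apply YoungDiagram.equivListRowLens.injective
    apply Subtype.ext
    change (diagram lam).rowLens = Y.rowLens
    rw [rowLens_diagram]
    exact List.mergeSort_eq_self _ Y.rowLens_sorted.pairwise
  refine ⟨lam, ?_⟩
  ext i
  rw [rowFun, hlam, hrow]

theorem count_parts (hN : n ≤ N) (lam : Nat.Partition n) {v : ℕ} (hv : v ≠ 0) :
    lam.parts.count v = #{i | rowFun N lam i = v} := by
  have h1 : lam.parts = ((List.range ((diagram lam).colLen 0)).map (diagram lam).rowLen : List ℕ) := by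
    rw [← Multiset.sort_eq lam.parts (· ≥ ·), ← rowLens_diagram]
    rfl
  have h2 : #{i | rowFun N lam i = v} = #{i ∈ range N | (diagram lam).rowLen i = v} := by
    rw [Finset.card_filter, Finset.card_filter, Finset.sum_range]
    rfl
  have h3 : {i ∈ range N | (diagram lam).rowLen i = v} =
      {i ∈ range ((diagram lam).colLen 0) | v = (diagram lam).rowLen i} := by
    ext i
    simp only [Finset.mem_filter, Finset.mem_range]
    constructor
    · rintro ⟨_, h⟩
      refine ⟨?_, h.symm⟩
      by_contra! hi
      exact hv (h ▸ rowLen_eq_zero _ hi)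
    · rintro ⟨h, h'⟩
      exact ⟨h.trans_le ((colLen_le lam 0).trans hN), h'.symm⟩
  rw [h2, h3, h1, ← Multiset.map_coe, Multiset.count_map]
  rfl

theorem colLen_eq_add_count (lam : Nat.Partition n) (j : ℕ) :
    (diagram lam).colLen j = (diagram lam).colLen (j + 1) + lam.parts.count (j + 1) := by
  rw [← card_lt_rowFun le_rfl, ← card_lt_rowFun le_rfl, count_parts le_rfl lam (Nat.succ_ne_zero j),
    ← Finset.card_union_of_disjoint]
  · congr 1
    ext i
    simp only [Finset.mem_filter, Finset.mem_union, Finset.mem_univ, true_and]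
    omega
  · rw [Finset.disjoint_filter]
    intro i _ h
    omega

/-- The multiplicity of `j + 1` is the difference of the lengths of columns `j` and `j + 1`. Even
multiplicities give even columns by descending from the empty columns beyond the first row. -/
theorem conjParts_even_iff (lam : Nat.Partition n) :
    (∀ k ∈ conjParts lam, Even k) ↔ ∀ i ∈ Finset.Icc 1 n, Even (lam.parts.count i) := by
  have h0 : ∀ j, (diagram lam).rowLen 0 ≤ j → (diagram lam).colLen j = 0 := fun j hj => by
    have := rowLen_eq_zero (diagram lam).transpose (i := j) (by rwa [YoungDiagram.colLen_transpose])
    rwa [YoungDiagram.rowLen_transpose] at this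
  have h1 : (∀ k ∈ conjParts lam, Even k) ↔ ∀ j, Even ((diagram lam).colLen j) := by
    simp only [conjParts, YoungDiagram.rowLens, YoungDiagram.colLen_transpose,
      Multiset.mem_coe, List.mem_map, List.mem_range, YoungDiagram.rowLen_transpose]
    constructor
    · intro h j
      by_cases hj : j < (diagram lam).rowLen 0
      · exact h _ ⟨j, hj, rfl⟩
      · rw [h0 j (not_lt.1 hj)]
        exact Even.zero
    · rintro h _ ⟨j, -, rfl⟩
      exact h j
  rw [h1]
  constructor
  · intro h i hi
    obtain ⟨j, rfl⟩ : ∃ j, i = j + 1 := ⟨i - 1, by have := (Finset.mem_Icc.1 hi).1; omega⟩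
    have h2 := h j
    rw [colLen_eq_add_count, Nat.even_add] at h2
    exact h2.1 (h (j + 1))
  · intro h
    have key : ∀ d j, n ≤ j + d → Even ((diagram lam).colLen j) := by
      intro d
      induction d with
      | zero =>
        intro j hj
        rw [h0 j ((rowLen_le lam 0).trans hj)]
        exact Even.zero
      | succ d ih =>
        intro j hj
        by_cases hjn : j + 1 ≤ n
        · rw [colLen_eq_add_count]
          exact (ih (j + 1) (by omega)).add (h _ (Finset.mem_Icc.2 ⟨by omega, hjn⟩))
        · rw [h0 j ((rowLen_le lam 0).trans (by omega))]
          exact Even.zero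
    exact fun j => key n j (by omega)

end RowLengths

/-! ### Removable vertical strips and their generating function -/

section Removable

variable {n N : ℕ}

/-- The sets of rows whose last boxes can be removed simultaneously: final segments of the blocks of
equal rows. -/
def IsRemovable (l : Fin N → ℕ) (S : Finset (Fin N)) : Prop :=
  (∀ i ∈ S, l i ≠ 0) ∧ ∀ i j, i ≤ j → l i = l j → i ∈ S → j ∈ S

instance (l : Fin N → ℕ) : DecidablePred (IsRemovable l) := fun S => by
  unfold IsRemovable
  infer_instance

/-- Shortening the rows in `S` can break monotonicity only inside a block of equal rows, where a
shortened row above an unshortened one is forbidden. -/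
theorem isRemovable_iff {l : Fin N → ℕ} (hl : Antitone l) (S : Finset (Fin N)) :
    IsRemovable l S ↔
      ∃ μ : Fin N → ℕ, Antitone μ ∧ ∀ i, l i = μ i + if i ∈ S then 1 else 0 := by
  constructor
  · rintro ⟨h0, h⟩
    refine ⟨fun i => l i - if i ∈ S then 1 else 0, fun i j hij => ?_, fun i => ?_⟩
    · have h1 := hl hij
      have h2 := h i j hij
      have h3 := h0 i
      by_cases hi : i ∈ S <;> by_cases hj : j ∈ S <;> simp only [hi, hj, if_true, if_false] <;>
        first | omega | skip
      have : l i ≠ l j := fun he => hj (h2 he hi)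
      omega
    · have h3 := h0 i
      by_cases hi : i ∈ S
      · have := h3 hi
        simp only [hi, if_true]
        omega
      · simp [hi]
  · rintro ⟨μ, hμ, h⟩
    refine ⟨fun i hi => ?_, fun i j hij he hi => ?_⟩
    · rw [h i, if_pos hi]
      omega
    · by_contra hj
      have h1 := hμ hij
      have h2 := h i
      have h3 := h j
      rw [if_pos hi] at h2
      rw [if_neg hj] at h3
      omega

/-- A finite chain has exactly one upper subset of each cardinality: adjoining a new minimum creates
only the full set. -/
theorem sum_pow_card_upper {α : Type*} [LinearOrder α] {R : Type*} [CommSemiring R] (s : R)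
    (B : Finset α) :
    ∑ T ∈ B.powerset with ∀ i ∈ B, ∀ j ∈ B, i ≤ j → i ∈ T → j ∈ T, s ^ #T =
      ∑ j ∈ range (#B + 1), s ^ j := by
  induction B using Finset.induction_on_min with
  | empty => simp
  | insert a B hlt ih =>
    have ha : a ∉ B := fun h => lt_irrefl _ (hlt a h)
    rw [Finset.card_insert_of_notMem ha, Finset.sum_range_succ, ← ih]
    have hset : (insert a B).powerset.filter
          (fun T => ∀ i ∈ insert a B, ∀ j ∈ insert a B, i ≤ j → i ∈ T → j ∈ T) =
        insert (insert a B)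
          (B.powerset.filter fun T => ∀ i ∈ B, ∀ j ∈ B, i ≤ j → i ∈ T → j ∈ T) := by
      ext T
      simp only [Finset.mem_filter, Finset.mem_powerset, Finset.mem_insert]
      constructor
      · rintro ⟨hT, h⟩
        by_cases haT : a ∈ T
        · left
          refine Finset.Subset.antisymm hT fun j hj => ?_
          refine h a (Or.inl rfl) j (Finset.mem_insert.1 hj) ?_ haT
          rcases Finset.mem_insert.1 hj with rfl | hj
          · exact le_rfl
          · exact (hlt j hj).le
        · exact Or.inr ⟨(Finset.subset_insert_iff_of_notMem haT).1 hT,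
            fun i hi j hj => h i (Or.inr hi) j (Or.inr hj)⟩
      · rintro (rfl | ⟨hT, h⟩)
        · exact ⟨Finset.Subset.refl _, fun i _ j hj _ _ => Finset.mem_insert.2 hj⟩
        · refine ⟨hT.trans (Finset.subset_insert _ _), ?_⟩
          rintro i hi j hj hij hiT
          have hiB := hT hiT
          rcases hj with rfl | hj
          · exact absurd (hlt i hiB) (not_lt.2 hij)
          · exact h i hiB j hj hij hiT
    rw [hset, Finset.sum_insert, Finset.card_insert_of_notMem ha, add_comm]
    simp only [Finset.mem_filter, Finset.mem_powerset, not_and]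
    intro h
    exact absurd (h (Finset.mem_insert_self a B)) ha

/-- A removable set is an independent choice of an upper subset in each block of rows of equal
nonzero length. -/
theorem sum_pow_card_removable {R : Type*} [CommSemiring R] (s : R) {l : Fin N → ℕ}
    (hl : ∀ i, l i ≤ n) :
    ∑ S : Finset (Fin N) with IsRemovable l S, s ^ #S =
      ∏ v ∈ Finset.Icc 1 n, ∑ j ∈ range (#{i | l i = v} + 1), s ^ j := by
  have hIcc : ∀ f : ℕ → R, ∏ v ∈ Finset.Icc 1 n, f v = ∏ v : Fin n, f (v + 1) := by
    intro f
    rw [← Finset.prod_range fun v => f (v + 1), Finset.range_eq_Ico, Finset.prod_Ico_add' f 0 n 1]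
    rfl
  rw [hIcc]
  simp only [← sum_pow_card_upper]
  rw [Finset.prod_univ_sum]
  symm
  refine Finset.sum_bij' (fun p _ => univ.biUnion p)
    (fun S _ v => S.filter fun i => l i = v + 1) ?_ ?_ ?_ ?_ ?_
  · intro p hp
    simp only [Fintype.mem_piFinset, Finset.mem_filter, Finset.mem_powerset] at hp
    have hpl : ∀ v, ∀ i ∈ p v, l i = v + 1 := fun v i hi => by
      simpa using (hp v).1 hi
    rw [Finset.mem_filter]
    simp only [IsRemovable, Finset.mem_biUnion, Finset.mem_univ, true_and]
    refine ⟨fun i ⟨v, hv⟩ => by rw [hpl v i hv]; omega, fun i j hij he ⟨v, hv⟩ => ⟨v, ?_⟩⟩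
    have h1 := hpl v i hv
    exact (hp v).2 i (by simpa using h1) j (by simpa [← he] using h1) hij hv
  · intro S hS
    simp only [Finset.mem_filter, Finset.mem_univ, true_and] at hS
    simp only [Fintype.mem_piFinset, Finset.mem_filter, Finset.mem_powerset]
    refine fun v => ⟨fun i hi => by simpa using (Finset.mem_filter.1 hi).2, ?_⟩
    intro i hi j hj hij ⟨hiS, _⟩
    simp only [Finset.mem_univ, true_and] at hi hj
    exact ⟨hS.2 i j hij (hi.trans hj.symm) hiS, hj⟩
  · intro p hp
    simp only [Fintype.mem_piFinset, Finset.mem_filter, Finset.mem_powerset] at hp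
    have hpl : ∀ v, ∀ i ∈ p v, l i = v + 1 := fun v i hi => by
      simpa using (hp v).1 hi
    ext v i
    simp only [Finset.mem_filter, Finset.mem_biUnion, Finset.mem_univ, true_and]
    constructor
    · rintro ⟨⟨w, hw⟩, hi⟩
      have := hpl w i hw
      have : w = v := Fin.ext (by omega)
      exact this ▸ hw
    · exact fun hi => ⟨⟨v, hi⟩, hpl v i hi⟩
  · intro S hS
    simp only [Finset.mem_filter, Finset.mem_univ, true_and] at hS
    ext i
    simp only [Finset.mem_filter, Finset.mem_biUnion, Finset.mem_univ, true_and]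
    refine ⟨fun ⟨_, h, _⟩ => h, fun h => ?_⟩
    have h1 := hS.1 i h
    have h2 := hl i
    exact ⟨⟨l i - 1, by omega⟩, h, by simp only; omega⟩
  · intro p hp
    simp only [Fintype.mem_piFinset, Finset.mem_filter, Finset.mem_powerset] at hp
    have hpl : ∀ v, ∀ i ∈ p v, l i = v + 1 := fun v i hi => by
      simpa using (hp v).1 hi
    rw [Finset.card_biUnion, Finset.prod_pow_eq_pow_sum]
    intro v _ w _ hvw
    rw [Function.onFun, Finset.disjoint_left]
    intro i hv hw
    have := hpl v i hv
    have := hpl w i hw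
    exact hvw (Fin.ext (by omega))

end Removable

/-! ### The generating function of the quadruple sums -/

section Quadruples

theorem parity_add (a b : Multiset ℕ) : parity (a + b) = parity a * parity b := by
  rw [parity, parity, parity, Multiset.countP_add, pow_add]

theorem parity_map_two_mul (c : Multiset ℕ) : parity (c.map (2 * ·)) = (-1) ^ c.card := by
  rw [parity, Multiset.countP_eq_card.2, Multiset.card_map]
  simp

theorem parity_two_nsmul (d : Multiset ℕ) : parity (2 • d) = 1 := by
  rw [two_nsmul, parity_add, parity, ← pow_add, ← two_mul, pow_mul, neg_one_sq, one_pow]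

theorem prod_map_neg_neg_pow (s : ℂ) (a : Multiset ℕ) :
    (a.map fun k => -(-s) ^ k).prod = parity a * s ^ a.sum := by
  induction a using Multiset.induction_on with
  | empty => simp [parity]
  | cons k a ih =>
    rw [Multiset.map_cons, Multiset.prod_cons, ih, Multiset.sum_cons, ← Multiset.singleton_add,
      parity_add, pow_add]
    by_cases hk : Even k
    · have : parity {k} = -1 := by
        rw [parity, Multiset.countP_eq_card.2 (by simpa using hk), Multiset.card_singleton, pow_one]
      rw [this, hk.neg_pow]
      push_cast
      ring
    · have : parity {k} = 1 := by
        rw [parity, Multiset.countP_eq_zero.2 (by simpa using hk), pow_zero]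
      rw [this, (Nat.not_even_iff_odd.1 hk).neg_pow]
      push_cast
      ring

variable {R : Type*} [CommRing R]

theorem coeff_mul_eq_of_le {f f' g g' : PowerSeries R} {n : ℕ}
    (hf : ∀ m ≤ n, PowerSeries.coeff m f = PowerSeries.coeff m f')
    (hg : ∀ m ≤ n, PowerSeries.coeff m g = PowerSeries.coeff m g') :
    ∀ m ≤ n, PowerSeries.coeff m (f * g) = PowerSeries.coeff m (f' * g') := by
  intro m hm
  rw [PowerSeries.coeff_mul, PowerSeries.coeff_mul]
  refine Finset.sum_congr rfl fun p hp => ?_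
  have := Finset.HasAntidiagonal.mem_antidiagonal.1 hp
  rw [hf p.1 (by omega), hg p.2 (by omega)]

theorem sum_partitionsUpTo {n m : ℕ} (hm : m ≤ n) (f : Multiset ℕ → R) :
    ∑ a ∈ partitionsUpTo n with m = a.sum, f a = ∑ π : Nat.Partition m, f π.parts := by
  symm
  refine Finset.sum_bij (fun π _ => π.parts) ?_ ?_ ?_ fun _ _ => rfl
  · intro π _
    rw [Finset.mem_filter, mem_partitionsUpTo, π.parts_sum]
    exact ⟨⟨fun i hi => π.parts_pos hi, hm⟩, rfl⟩
  · intro π _ π' _ h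
    exact Nat.Partition.ext h
  · intro a ha
    rw [Finset.mem_filter, mem_partitionsUpTo] at ha
    exact ⟨⟨a, fun {i} hi => ha.1.1 i hi, ha.2.symm⟩, Finset.mem_univ _, rfl⟩

variable [Algebra ℂ R]

theorem coeff_sum_partitionsUpTo (P : ℕ → R) {n m : ℕ} (hm : m ≤ n) :
    PowerSeries.coeff m (∑ a ∈ partitionsUpTo n,
      PowerSeries.monomial a.sum ((zee a : ℂ)⁻¹ • (a.map P).prod)) =
    PowerSeries.coeff m (expSeries P) := by
  rw [map_sum, coeff_expSeries, cycleExp,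
    ← sum_partitionsUpTo hm fun a => (zee a : ℂ)⁻¹ • (a.map P).prod, Finset.sum_filter]
  exact Finset.sum_congr rfl fun a _ => PowerSeries.coeff_monomial _ _ _

/-- With `P` cut off at odd indices only partitions with all parts even contribute, and these are
the `2 · τ`. Used for `τ_s` as well as `τ_p`, since both enter through `z` of the doubled partition.
-/
theorem coeff_sum_even_partitionsUpTo (P : ℕ → R) {n m : ℕ} (hm : m ≤ n) :
    PowerSeries.coeff m (∑ a ∈ partitionsUpTo n,
      PowerSeries.monomial (2 * a.sum)
        ((zee (a.map (2 * ·)) : ℂ)⁻¹ • (a.map fun k => P (2 * k)).prod)) =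
    PowerSeries.coeff m (expSeries fun k => if Even k then P k else 0) := by
  symm
  rw [← coeff_sum_partitionsUpTo _ hm, map_sum, map_sum]
  simp only [PowerSeries.coeff_monomial]
  rw [← Finset.sum_filter, ← Finset.sum_filter,
    ← Finset.sum_filter_of_ne (p := fun a : Multiset ℕ => ∀ k ∈ a, Even k)]
  · symm
    refine Finset.sum_bij (fun a _ => a.map (2 * ·)) ?_ ?_ ?_ ?_
    · intro a ha
      simp only [Finset.mem_filter, mem_partitionsUpTo] at ha ⊢
      have hsum : (a.map (2 * ·)).sum = 2 * a.sum := Multiset.sum_map_mul_left ..|>.trans (by simp)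
      rw [hsum]
      refine ⟨⟨⟨?_, by omega⟩, ha.2⟩, ?_⟩
      · intro i hi
        obtain ⟨k, hk, rfl⟩ := Multiset.mem_map.1 hi
        have := ha.1.1 k hk
        omega
      · intro i hi
        obtain ⟨k, hk, rfl⟩ := Multiset.mem_map.1 hi
        exact even_two_mul k
    · intro a _ b _ h
      exact Multiset.map_injective (fun x y h => Nat.eq_of_mul_eq_mul_left two_pos h) h
    · intro b hb
      simp only [Finset.mem_filter, mem_partitionsUpTo] at hb
      have hb2 : (b.map (· / 2)).map (2 * ·) = b := by
        rw [Multiset.map_map]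
        conv_rhs => rw [← Multiset.map_id b]
        refine Multiset.map_congr rfl fun k hk => ?_
        obtain ⟨j, hj⟩ := hb.2 k hk
        simp only [Function.comp, id]
        omega
      have hsum : ((b.map (· / 2)).map (2 * ·)).sum = 2 * (b.map (· / 2)).sum :=
        Multiset.sum_map_mul_left ..|>.trans (by simp)
      rw [hb2] at hsum
      refine ⟨b.map (· / 2), ?_, hb2⟩
      simp only [Finset.mem_filter, mem_partitionsUpTo]
      refine ⟨⟨?_, by omega⟩, by omega⟩
      intro i hi
      obtain ⟨k, hk, rfl⟩ := Multiset.mem_map.1 hi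
      have := hb.1.1.1 k hk
      obtain ⟨j, hj⟩ := hb.2 k hk
      omega
    · intro a _
      rw [Multiset.map_map]
      congr 2
      refine Multiset.map_congr rfl fun k _ => ?_
      simp
  · intro a _ hne k hk
    by_contra hodd
    refine hne ?_
    rw [Multiset.prod_eq_zero (Multiset.mem_map.2 ⟨k, hk, if_neg hodd⟩), smul_zero]

/-- `C_π` and `D_π` in a uniform way, for `s = 1` and `s = -1`. -/
noncomputable def coeffSign (s : ℂ) (m : Multiset ℕ) : ℂ :=
  ∑ q ∈ quadruples m, s ^ q.2.1.sum * quadWeight q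

theorem coeffSign_one (m : Multiset ℕ) : coeffSign 1 m = coeffC m := by
  simp only [coeffSign, coeffC, Cplus, Cminus, one_pow, one_mul, ← Nat.not_even_iff_odd]
  rw [Finset.sum_filter_add_sum_filter_not]

theorem coeffSign_neg_one (m : Multiset ℕ) : coeffSign (-1) m = coeffD m := by
  simp only [coeffSign, coeffD, Cplus, Cminus, ← Nat.not_even_iff_odd]
  rw [← Finset.sum_filter_add_sum_filter_not (quadruples m) (fun q => Even q.2.1.sum),
    sub_eq_add_neg, ← Finset.sum_neg_distrib]
  congr 1
  · refine Finset.sum_congr rfl fun q hq => ?_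
    rw [(Finset.mem_filter.1 hq).2.neg_one_pow, one_mul]
  · refine Finset.sum_congr rfl fun q hq => ?_
    rw [(Nat.not_even_iff_odd.1 (Finset.mem_filter.1 hq).2).neg_one_pow, neg_one_mul]

variable {N : ℕ}

/-- A quadruple determines `π`, so the double sum runs over all quadruples of total weight `n`, with
no reference to `π`. -/
theorem sum_quadruples {n : ℕ} {M : Type*} [AddCommMonoid M]
    (f : Multiset ℕ × Multiset ℕ × Multiset ℕ × Multiset ℕ → M) :
    ∑ π : Nat.Partition n, ∑ q ∈ quadruples π.parts, f q =
      ∑ q ∈ partitionsUpTo n ×ˢ partitionsUpTo n ×ˢ partitionsUpTo n ×ˢ partitionsUpTo n with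
        n = q.1.sum + (q.2.1.sum + (2 * q.2.2.1.sum + 2 * q.2.2.2.sum)), f q := by
  have hinj : Set.InjOn (Nat.Partition.parts (n := n)) (univ : Finset (Nat.Partition n)) :=
    fun _ _ _ _ h => Nat.Partition.ext h
  have hsum : ∀ q : Multiset ℕ × Multiset ℕ × Multiset ℕ × Multiset ℕ,
      (q.1 + q.2.1 + q.2.2.1.map (2 * ·) + 2 • q.2.2.2).sum =
        q.1.sum + (q.2.1.sum + (2 * q.2.2.1.sum + 2 * q.2.2.2.sum)) := by
    intro q
    simp [two_nsmul, two_mul, Multiset.sum_map_add]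
    ring
  rw [← Finset.sum_image (f := fun m => ∑ q ∈ quadruples m, f q) hinj]
  symm
  rw [← Finset.sum_fiberwise_of_maps_to (t := univ.image Nat.Partition.parts)
      (g := fun q => q.1 + q.2.1 + q.2.2.1.map (2 * ·) + 2 • q.2.2.2)]
  · refine Finset.sum_congr rfl fun m hm => Finset.sum_congr ?_ fun _ _ => rfl
    obtain ⟨π, -, rfl⟩ := Finset.mem_image.1 hm
    ext q
    simp only [quadruples, Finset.mem_filter, π.parts_sum]
    constructor
    · rintro ⟨⟨h1, _⟩, h2⟩
      exact ⟨h1, h2⟩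
    · rintro ⟨h1, h2⟩
      exact ⟨⟨h1, by rw [← hsum, h2, π.parts_sum]⟩, h2⟩
  · intro q hq
    obtain ⟨h1, h2⟩ := Finset.mem_filter.1 hq
    simp only [Finset.mem_product, mem_partitionsUpTo] at h1
    refine Finset.mem_image.2 ⟨⟨_, fun {i} hi => ?_, (hsum q).trans h2.symm⟩, Finset.mem_univ _, rfl⟩
    simp only [two_nsmul, Multiset.mem_add, Multiset.mem_map] at hi
    rcases hi with ((hi | hi) | ⟨k, hk, rfl⟩) | hi | hi
    · exact h1.1.1 i hi
    · exact h1.2.1.1 i hi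
    · have := h1.2.2.1.1 k hk
      omega
    · exact h1.2.2.2.1 i hi
    · exact h1.2.2.2.1 i hi

/-- The parity of `2 · τ_s` cancels the sign `(-1)^{ℓ(τ_s)}`, and `2 τ_p` has parity `1` and turns
each `p_k` into its square; the other two parities are absorbed into the exponents. -/
theorem quadruple_term (s : ℂ) (p : ℕ → MvPolynomial (Fin N) ℂ) (a b c d : Multiset ℕ) :
    ((parity (a + b + c.map (2 * ·) + 2 • d) : ℂ) * (s ^ b.sum * quadWeight (a, b, c, d))) •
        ((a + b + c.map (2 * ·) + 2 • d).map p).prod =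
      ((zee a : ℂ)⁻¹ • (a.map fun k => -(-1 : ℂ) ^ k • p k).prod) *
        (((zee b : ℂ)⁻¹ • (b.map fun k => -(-s) ^ k • p k).prod) *
          (((zee (c.map (2 * ·)) : ℂ)⁻¹ • (c.map fun k => p (2 * k)).prod) *
            ((zee (d.map (2 * ·)) : ℂ)⁻¹ • (d.map fun k => p (2 * k / 2) ^ 2).prod))) := by
  have hd : (d.map fun k => p (2 * k / 2) ^ 2).prod = (d.map p).prod * (d.map p).prod := by
    rw [← Multiset.prod_map_mul]
    congr 1
    exact Multiset.map_congr rfl fun k _ => by rw [Nat.mul_div_cancel_left k two_pos, sq]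
  have hc : ((c.map (2 * ·)).map p).prod = (c.map fun k => p (2 * k)).prod := by
    rw [Multiset.map_map]
    rfl
  have h1 : (-1 : ℂ) ^ c.card * (-1) ^ c.card = 1 := by
    rw [← mul_pow, neg_one_mul, neg_neg, one_pow]
  rw [parity_add, parity_add, parity_add, parity_map_two_mul, parity_two_nsmul, quadWeight,
    prod_map_smul, prod_map_smul, prod_map_neg_neg_pow, prod_map_neg_neg_pow, hd,
    Multiset.map_add, Multiset.map_add, Multiset.map_add, Multiset.prod_add, Multiset.prod_add,
    Multiset.prod_add, hc, two_nsmul, Multiset.map_add, Multiset.prod_add]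
  generalize (a.map p).prod = A, (b.map p).prod = B, (d.map p).prod = D,
    (c.map fun k => p (2 * k)).prod = C
  simp only [smul_smul, smul_mul_smul_comm, one_pow, mul_one]
  congr 1
  · push_cast
    rw [div_eq_mul_inv, mul_inv, mul_inv, mul_inv]
    linear_combination ((parity a : ℂ) * parity b * s ^ b.sum * (zee a : ℂ)⁻¹ * (zee b : ℂ)⁻¹ *
      (zee (c.map (2 * ·)) : ℂ)⁻¹ * (zee (d.map (2 * ·)) : ℂ)⁻¹) * h1
  · ring

theorem sum_parity_coeffSign (s : ℂ) (n : ℕ) (p : ℕ → MvPolynomial (Fin N) ℂ) :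
    ∑ π : Nat.Partition n, ((parity π.parts : ℂ) * coeffSign s π.parts) • (π.parts.map p).prod =
      PowerSeries.coeff n (expSeries (squareWeight p) * expSeries fun k => -(-s) ^ k • p k) := by
  let Pe : ℕ → MvPolynomial (Fin N) ℂ := fun k => if Even k then p k else 0
  let Pd : ℕ → MvPolynomial (Fin N) ℂ := fun k => if Even k then p (k / 2) ^ 2 else 0
  -- For even `k` the term `-p_k` of `ρ₊` is cancelled by the `p_k` of `τ_s`, leaving the `p_{k/2}²`
  -- of `τ_p`.
  have hP : squareWeight p = (fun k => -(-1 : ℂ) ^ k • p k) + (Pe + Pd) := by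
    ext1 k
    simp only [squareWeight, Pi.add_apply, Pe, Pd]
    by_cases hk : Even k
    · simp [hk, hk.neg_one_pow]
    · simp [hk, (Nat.not_even_iff_odd.1 hk).neg_one_pow]
  have hprod : expSeries (squareWeight p) * expSeries (fun k => -(-s) ^ k • p k) =
      expSeries (fun k => -(-1 : ℂ) ^ k • p k) *
        (expSeries (fun k => -(-s) ^ k • p k) * (expSeries Pe * expSeries Pd)) := by
    rw [hP, expSeries_add, expSeries_add]
    ring
  -- Only degrees up to `n` matter, so each exponential may be replaced by a finite sum over
  -- `partitionsUpTo n`.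
  have htrunc := coeff_mul_eq_of_le (n := n)
    (fun m hm => coeff_sum_partitionsUpTo (fun k => -(-1 : ℂ) ^ k • p k) hm)
    (coeff_mul_eq_of_le (fun m hm => coeff_sum_partitionsUpTo (fun k => -(-s) ^ k • p k) hm)
      (coeff_mul_eq_of_le (fun m hm => coeff_sum_even_partitionsUpTo p hm)
        (fun m hm => coeff_sum_even_partitionsUpTo (fun k => p (k / 2) ^ 2) hm))) n le_rfl
  rw [hprod, ← htrunc]
  simp only [Finset.sum_mul_sum, ← Finset.sum_product', PowerSeries.monomial_mul_monomial]
  rw [map_sum]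
  simp only [PowerSeries.coeff_monomial]
  rw [← Finset.sum_filter, ← sum_quadruples]
  refine Finset.sum_congr rfl fun π _ => ?_
  rw [coeffSign, Finset.mul_sum, Finset.sum_smul]
  refine Finset.sum_congr rfl fun q hq => ?_
  obtain ⟨a, b, c, d⟩ := q
  have hq' : a + b + c.map (2 * ·) + 2 • d = π.parts := (Finset.mem_filter.1 hq).2
  rw [← hq']
  exact quadruple_term s p a b c d

end Quadruples

/-! ### The multiplicities and the final evaluation -/

section Multiplicities

variable {n N : ℕ}

theorem squareWeight_psum_isSymmetric (k : ℕ) :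
    (squareWeight (psum (Fin N) ℂ) k).IsSymmetric := by
  rw [squareWeight]
  split_ifs
  · intro e
    rw [map_pow, psum_isSymmetric (Fin N) ℂ (k / 2) e]
  · exact psum_isSymmetric (Fin N) ℂ k

/-- The symmetric function `∑_h p_{h²} / m!` is the multiplicity free sum of all Schur functions. -/
theorem cf_alternant_mul_cycleExp_squareWeight (hN : n ≤ N) (lam : Nat.Partition n) :
    cf (alternant N * cycleExp (squareWeight (psum (Fin N) ℂ)) n) (shift (rowFun N lam)) = 1 := by
  have h1 : (n.factorial : ℂ) • cycleExp (squareWeight (psum (Fin N) ℂ)) n =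
      ∑ h : Equiv.Perm (Fin n), ((permType (h * h)).parts.map (psum (Fin N) ℂ)).prod := by
    have hcard : ∀ k, k = n → (n.factorial : ℂ) • cycleExp (squareWeight (psum (Fin N) ℂ)) n =
        (k.factorial : ℂ) • cycleExp (squareWeight (psum (Fin N) ℂ)) k := by
      rintro _ rfl
      rfl
    rw [hcard _ (Fintype.card_fin n), ← sum_perm_prod_parts]
    refine Finset.sum_congr rfl fun g _ => ?_
    exact (prod_parts_sq (psum (Fin N) ℂ) n (Fin n) g (Fintype.card_fin n)).symm
  have h2 : (n.factorial : ℂ) *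
      cf (alternant N * cycleExp (squareWeight (psum (Fin N) ℂ)) n) (shift (rowFun N lam)) =
      n.factorial := by
    -- By the Frobenius formula, the coefficient extracted here is the character sum over squares,
    -- that is, the Frobenius–Schur indicator times `n!`.
    rw [← cf_smul, ← mul_smul_comm, h1, Finset.mul_sum, cf_sum, ← sum_character_sq lam]
    refine Finset.sum_congr rfl fun h _ => ?_
    rw [← chi_permType, chi_eq_psi hN, psi]
  exact mul_left_cancel₀ (Nat.cast_ne_zero.2 n.factorial_ne_zero) (h2.trans (mul_one _).symm)

/-- Removing the strip `S` either leaves a partition of `m`, where the sum of all Schur functions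
has coefficient `1`, or a coefficient of an alternating polynomial that vanishes. -/
theorem cf_mul_prod_X_eq_ite (hN : n ≤ N) (lam : Nat.Partition n) {m : ℕ} {S : Finset (Fin N)}
    (hm : m + #S = n) :
    cf (alternant N * cycleExp (squareWeight (psum (Fin N) ℂ)) m * ∏ i ∈ S, X i)
      (shift (rowFun N lam)) = if IsRemovable (rowFun N lam) S then 1 else 0 := by
  have hG : IsAlternating (alternant N * cycleExp (squareWeight (psum (Fin N) ℂ)) m) :=
    isAlternating_alternant.mul (cycleExp_isSymmetric squareWeight_psum_isSymmetric m)
  have hl := rowFun_antitone N lam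
  split_ifs with h
  · obtain ⟨μ, hμ, hS⟩ := (isRemovable_iff hl S).1 h
    have hsum : ∑ i, μ i = m := by
      have h1 := sum_rowFun hN lam
      rw [Finset.sum_congr rfl fun i _ => hS i, Finset.sum_add_distrib, Finset.sum_ite_mem,
        Finset.univ_inter, Finset.sum_const, smul_eq_mul, mul_one] at h1
      omega
    obtain ⟨nu, rfl⟩ := exists_rowFun_eq hμ hsum
    rw [cf_mul_prod_X_of_eq hS, cf_alternant_mul_cycleExp_squareWeight (by omega) nu]
  · by_contra hne
    obtain ⟨μ, hμ, hS, -⟩ := exists_of_cf_mul_prod_X_ne_zero hG hl hne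
    exact h ((isRemovable_iff hl S).2 ⟨μ, hμ, hS⟩)

/-- The coefficient at `lam` of the sum of all Schur functions times `∑ s^r e_r`, found by Pieri's
rule as a sum over removable strips. The number of variables is `n`, the least for which every
partition of `n` is visible. -/
theorem sum_parity_coeffSign_chi (s : ℂ) (lam : Nat.Partition n) :
    ∑ π : Nat.Partition n, (parity π.parts : ℂ) * coeffSign s π.parts * chi lam π =
      ∏ v ∈ Finset.Icc 1 n, ∑ j ∈ range (lam.parts.count v + 1), s ^ j := by
  have h1 : ∑ π : Nat.Partition n, (parity π.parts : ℂ) * coeffSign s π.parts * chi lam π =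
      cf (alternant n * ∑ π : Nat.Partition n, ((parity π.parts : ℂ) * coeffSign s π.parts) •
        (π.parts.map (psum (Fin n) ℂ)).prod) (shift (rowFun n lam)) := by
    rw [Finset.mul_sum, cf_sum]
    refine Finset.sum_congr rfl fun π _ => ?_
    rw [mul_smul_comm, cf_smul, chi_eq_psi le_rfl, psi]
  have h2 : ∀ j ∈ range (n + 1),
      cf (alternant n * (s ^ j • esymm (Fin n) ℂ j *
        cycleExp (squareWeight (psum (Fin n) ℂ)) (n - j))) (shift (rowFun n lam)) =
      ∑ S ∈ powersetCard j univ, if IsRemovable (rowFun n lam) S then s ^ #S else 0 := by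
    intro j hj
    rw [mul_comm (_ • _), mul_smul_comm, mul_smul_comm, cf_smul, ← mul_assoc, cf_mul_esymm, Finset.mul_sum]
    refine Finset.sum_congr rfl fun S hS => ?_
    have hcard := (Finset.mem_powersetCard.1 hS).2
    have hj' := Finset.mem_range.1 hj
    rw [cf_mul_prod_X_eq_ite le_rfl lam (by omega), hcard, mul_ite, mul_one, mul_zero]
  rw [h1, sum_parity_coeffSign, mul_comm (expSeries (squareWeight _)),
    PowerSeries.coeff_mul, Finset.Nat.sum_antidiagonal_eq_sum_range_succ_mk, Finset.mul_sum,
    cf_sum]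
  simp only [coeff_expSeries, cycleExp_neg_psum]
  have h3 := Finset.sum_powerset (univ : Finset (Fin n))
    fun S => if IsRemovable (rowFun n lam) S then s ^ #S else 0
  rw [Finset.card_univ, Fintype.card_fin] at h3
  rw [Finset.sum_congr rfl h2, ← h3, Finset.powerset_univ, ← Finset.sum_filter,
    sum_pow_card_removable s (l := rowFun n lam) fun i => rowLen_le lam i]
  refine Finset.prod_congr rfl fun v hv => ?_
  rw [count_parts le_rfl lam (by have := (Finset.mem_Icc.1 hv).1; omega)]

end Multiplicities

end SchurMult

theorem mainTheorem5 (n : ℕ) (lam : Nat.Partition n) :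
    SchurMult.aPlus lam = ∏ i ∈ Finset.Icc 1 n, ((lam.parts.count i : ℂ) + 1) ∧
    SchurMult.aMinus lam = if ∀ k ∈ SchurMult.conjParts lam, Even k then 1 else 0 := by
  constructor
  · have h := SchurMult.sum_parity_coeffSign_chi 1 lam
    simp only [SchurMult.coeffSign_one] at h
    rw [SchurMult.aPlus, h]
    simp
  · have h := SchurMult.sum_parity_coeffSign_chi (-1) lam
    simp only [SchurMult.coeffSign_neg_one] at h
    rw [SchurMult.aMinus, h]
    have hgeom : ∀ r : ℕ, ∑ j ∈ Finset.range (r + 1), (-1 : ℂ) ^ j = if Even r then 1 else 0 := by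
      intro r
      rw [neg_one_geom_sum]
      by_cases hr : Even r <;> simp [hr, Nat.even_add_one]
    simp only [hgeom, Finset.prod_ite_zero, Finset.prod_const_one, SchurMult.conjParts_even_iff]
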